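/- Let $c\ge 0$ and let $\mathcal C=\{y\in\mathbb R^4: y_4=c\sqrt{y_1^2+y_2^2+y_3^2}\}$, parametrized by $x\in\mathbb R^3\mapsto (x,c|x|)$, with inverse metric $g^{ij}(x)=\delta_{ij}-\frac{c^2}{1+c^2}\frac{x_ix_j}{|x|^2}$. Write $r=|x|$ and $x_3=r\cos\phi$, and for real $\beta$ consider the equation $$\frac{\beta(\beta+1)}{1+c^2}f(\phi)+\frac{\cos\phi}{\sin\phi}f'(\phi)+f''(\phi)=0,\qquad 0<\phi<\pi. \tag{1}$$ Let $f$ be the solution of (1) with $\beta=1$ that is regular at $0$ with $f'(0)=0$, is positive on $[0,\phi_0)$ for some $\phi_0\in(0,\pi)$, and satisfies $f(\phi_0)=0$, $f'(\phi_0)=-1$. Let $\Phi_c=rf(\phi)$ for $\phi\le\phi_0$ and $\Phi_c=0$ for $\phi>\phi_0$ be the corresponding symmetric $1$-homogeneous solution, and let $\Gamma=\{\Phi_c>0\}\subset\mathbb R^3$. Let $H$ be the mean curvature (sum of the principal curvatures) of $\partial\Gamma\setminus\{0\}$ in flat $\mathbb R^3$, with the sign for which $H=-\operatorname{div}\nu$,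 where $\nu$ is the unit normal pointing out of $\Gamma$, and let $H_1$ be its value at $r=1$. Let $d\sigma$ be the Euclidean surface measure on $\partial\Gamma$. Let $g$ be a solution of (1) with $\beta=-1/2$ that is regular at $0$ with $g'(0)=0$, and with $g>0$ on $[0,\pi)$. Then the stability inequality $$\int_{\partial\Gamma}HF^2\,d\sigma\le\int_\Gamma g^{ij}F_iF_j\,dx$$ holds for every $F\in C^\infty(\overline\Gamma)$ for which there is an $R>0$ with $F(x)=0$ whenever $|x|\notin(R^{-1},R)$, if and only if $$H_1\le\frac{g'(\phi_0)}{g(\phi_0)}.$$ -/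

import Mathlib

open Set MeasureTheory
open scoped ContDiff

noncomputable section

namespace OnePhaseCone

/-- Euclidean three-space. The coordinates `x` parametrize the cone
`y₄ = c √(y₁² + y₂² + y₃²)` in `ℝ⁴` by `x ↦ (x, c |x|)`. -/
abbrev E3 : Type := EuclideanSpace ℝ (Fin 3)

/-! ### The metric of the cone in the coordinates `x` -/

/-- The metric `g_{ij} = δ_{ij} + c² x_i x_j / |x|²` that the cone inherits from `ℝ⁴`
(Gram matrix of the partial derivatives of `x ↦ (x, c |x|)`, away from the vertex). -/
def coneMetric (c : ℝ) (x : E3) : Matrix (Fin 3) (Fin 3) ℝ :=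
  Matrix.of fun i j => (if i = j then 1 else 0) + c ^ 2 * (x i * x j) / ‖x‖ ^ 2

/-- The inverse metric `g^{ij}`, e.g. `g^{11} = (r² + c² (x₂² + x₃²)) / ((1 + c²) r²)` and
`g^{12} = - c² x₁ x₂ / ((1 + c²) r²)`, where `r = |x|`. -/
def coneInvMetric (c : ℝ) (x : E3) : Matrix (Fin 3) (Fin 3) ℝ :=
  Matrix.of fun i j =>
    ((if i = j then (1 + c ^ 2) * ‖x‖ ^ 2 else 0) - c ^ 2 * (x i * x j)) /
      ((1 + c ^ 2) * ‖x‖ ^ 2)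

theorem coneMetric_mul_coneInvMetric (c : ℝ) {x : E3} (hx : x ≠ 0) :
    coneMetric c x * coneInvMetric c x = 1 := by
  have hn : ‖x‖ ≠ 0 := norm_ne_zero_iff.mpr hx
  have hc : (1 + c ^ 2) ≠ 0 := by positivity
  have hs : ‖x‖ ^ 2 = x 0 ^ 2 + x 1 ^ 2 + x 2 ^ 2 := by
    rw [EuclideanSpace.real_norm_sq_eq, Fin.sum_univ_three]
  have hn2 : x 0 ^ 2 + x 1 ^ 2 + x 2 ^ 2 ≠ 0 := by rw [← hs]; positivity
  ext i j
  fin_cases i <;> fin_cases j <;>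
    simp [coneMetric, coneInvMetric, Matrix.mul_apply, Fin.sum_univ_three, hs] <;>
    field_simp <;> ring

/-- The energy density `g^{ij} F_i F_j` at `x`. -/
def energyDensity (c : ℝ) (F : E3 → ℝ) (x : E3) : ℝ :=
  ∑ i : Fin 3, ∑ j : Fin 3, coneInvMetric c x i j *
    fderiv ℝ F x (EuclideanSpace.single i 1) * fderiv ℝ F x (EuclideanSpace.single j 1)

/-! ### The symmetric solution -/

/-- `f` solves `β (β + 1) / (1 + c²) f + (cos φ / sin φ) f' + f'' = 0` on `(0, π)` and is regular
at `φ = 0`, with (one-sided) derivative `f'(0) = 0`. -/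
structure IsRegularSolution (c β : ℝ) (f : ℝ → ℝ) : Prop where
  diff : ∀ φ ∈ Ioo 0 Real.pi, DifferentiableAt ℝ f φ
  diff_deriv : ∀ φ ∈ Ioo 0 Real.pi, DifferentiableAt ℝ (deriv f) φ
  ode : ∀ φ ∈ Ioo 0 Real.pi,
    β * (β + 1) / (1 + c ^ 2) * f φ + Real.cos φ / Real.sin φ * deriv f φ
      + deriv (deriv f) φ = 0
  deriv_zero : HasDerivWithinAt f 0 (Ici 0) 0

/-- `f` is the angular profile `f_{1,c}` of the symmetric `1`-homogeneous solution and `φ₀` is the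
angle of its free boundary: `f` is the regular solution with `β = 1`, positive up to its zero `φ₀`,
and normalized by the free boundary condition `|f'(φ₀)| = 1`. -/
structure IsSymmetricProfile (c : ℝ) (f : ℝ → ℝ) (φ₀ : ℝ) : Prop where
  sol : IsRegularSolution c 1 f
  mem : φ₀ ∈ Ioo 0 Real.pi
  pos : ∀ φ ∈ Ico 0 φ₀, 0 < f φ
  zero : f φ₀ = 0
  normalized : deriv f φ₀ = -1

/-- The polar angle `φ ∈ [0, π]` of `x ≠ 0`, i.e. `x₃ = r cos φ`. -/
def polarAngle (x : E3) : ℝ := Real.arccos (x 2 / ‖x‖)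

open Classical in
/-- `Φ(r, φ) = r f(φ)` for `φ ≤ φ₀`, continued by zero: the solution is nonnegative. -/
def symmetricSolution (f : ℝ → ℝ) (φ₀ : ℝ) (x : E3) : ℝ :=
  if polarAngle x ≤ φ₀ then ‖x‖ * f (polarAngle x) else 0

/-- The positivity set `Γ = {u > 0}`. -/
def positivitySet (u : E3 → ℝ) : Set E3 := {x | 0 < u x}

/-! ### Parametrized surfaces in Euclidean three-space -/

/-- The area element `√(EG - F²)` of the parametrized surface `z`. -/
def areaElement (z : ℝ → ℝ → E3) (s t : ℝ) : ℝ :=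
  let zs := deriv (fun a => z a t) s
  let zt := deriv (fun b => z s b) t
  Real.sqrt (inner ℝ zs zs * inner ℝ zt zt - inner ℝ zs zt ^ 2)

/-- The unit normal `(z_t × z_s) / |z_t × z_s|` of the parametrized surface `z`. -/
def unitNormal (z : ℝ → ℝ → E3) (s t : ℝ) : E3 :=
  let zs := deriv (fun a => z a t) s
  let zt := deriv (fun b => z s b) t
  let n : E3 := WithLp.toLp 2 (crossProduct (WithLp.ofLp zt) (WithLp.ofLp zs))
  ‖n‖⁻¹ • n

/-- The mean curvature of the parametrized surface `z` with respect to `ν = unitNormal z`: the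
trace `(L G - 2 M F + N E) / (E G - F²)` of the second fundamental form `⟨∂ᵢ∂ⱼz, ν⟩` with respect to
the first, i.e. the sum of the principal curvatures, `H = - div ν`. If `ν` points out of a domain
`Γ`, then `H ≥ 0` where the complement of `Γ` is convex. -/
def meanCurvature (z : ℝ → ℝ → E3) (s t : ℝ) : ℝ :=
  let zs := deriv (fun a => z a t) s
  let zt := deriv (fun b => z s b) t
  let zss := deriv (fun a => deriv (fun a' => z a' t) a) s
  let zst := deriv (fun a => deriv (fun b => z a b) t) s
  let ztt := deriv (fun b => deriv (fun b' => z s b') b) t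
  let ν := unitNormal z s t
  (inner ℝ zss ν * inner ℝ zt zt - 2 * (inner ℝ zst ν * inner ℝ zs zt)
      + inner ℝ ztt ν * inner ℝ zs zs) /
    (inner ℝ zs zs * inner ℝ zt zt - inner ℝ zs zt ^ 2)

/-- The surface `{φ = φ₀}` in spherical coordinates `(r, θ)`. Its `unitNormal` points in the
direction of increasing `φ`, that is, out of `{φ < φ₀}`. -/
def conicalSurface (φ₀ : ℝ) (r θ : ℝ) : E3 :=
  !₂[r * Real.cos θ * Real.sin φ₀, r * Real.sin θ * Real.sin φ₀, r * Real.cos φ₀]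

/-- The range `0 < r < ∞`, `-π < θ ≤ π` of the parameters `(r, θ)`. -/
def parameterDomain : Set (ℝ × ℝ) := Ioi 0 ×ˢ Ioc (-Real.pi) Real.pi

/-! ### The stability inequality -/

/-- The test functions: `F ∈ C^∞(closure Γ)` with `F(x) = 0` unless `R⁻¹ < |x| < R`, for some
`R`. Only the values of `F` on `closure Γ` matter. -/
def IsTestFunction (Γ : Set E3) (F : E3 → ℝ) : Prop :=
  ContDiffOn ℝ ∞ F (closure Γ) ∧
    ∃ R : ℝ, 0 < R ∧ ∀ x ∈ closure Γ, ‖x‖ ∉ Ioo R⁻¹ R → F x = 0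

/-- `∫_{∂Γ} H F² dσ ≤ ∫_Γ g^{ij} F_i F_j dx` for all test functions `F`, where `Γ` has the boundary
(up to the vertex) parametrized by `z` on `parameterDomain`; `H` and `dσ` are the mean curvature and
the area of the surface in flat `ℝ³`, and `dx` is Lebesgue measure. -/
def StabilityInequality (c : ℝ) (Γ : Set E3) (z : ℝ → ℝ → E3) : Prop :=
  ∀ F : E3 → ℝ, IsTestFunction Γ F →
    ∫ p in parameterDomain,
        meanCurvature z p.1 p.2 * F (z p.1 p.2) ^ 2 * areaElement z p.1 p.2
      ≤ ∫ x in Γ, energyDensity c F x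

/-! ### `conicalSurface φ₀` parametrizes the free boundary -/

theorem positivitySet_symmetricSolution {c : ℝ} {f : ℝ → ℝ} {φ₀ : ℝ}
    (hf : IsSymmetricProfile c f φ₀) :
    positivitySet (symmetricSolution f φ₀) = {x | ‖x‖ * Real.cos φ₀ < x 2} := by
  ext x
  obtain ⟨h0, hpi⟩ := hf.mem
  simp only [positivitySet, symmetricSolution, mem_ofPred_eq]
  rcases eq_or_ne x 0 with rfl | hx
  · simp
  have hn : 0 < ‖x‖ := norm_pos_iff.mpr hx
  have hle : |x 2| ≤ ‖x‖ := by simpa using PiLp.norm_apply_le x 2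
  have hle' := abs_le.mp hle
  have hcos : Real.cos (polarAngle x) = x 2 / ‖x‖ :=
    Real.cos_arccos (by rw [le_div_iff₀ hn]; linarith) (by rw [div_le_iff₀ hn]; linarith)
  have hmem : polarAngle x ∈ Icc 0 Real.pi := ⟨Real.arccos_nonneg _, Real.arccos_le_pi _⟩
  have key : polarAngle x < φ₀ ↔ ‖x‖ * Real.cos φ₀ < x 2 := by
    rw [← Real.strictAntiOn_cos.lt_iff_gt (a := φ₀) ⟨h0.le, hpi.le⟩ hmem, hcos, lt_div_iff₀ hn,
      mul_comm]
  rw [← key]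
  constructor
  · intro h
    split_ifs at h with h1
    · rcases h1.lt_or_eq with h2 | h2
      · exact h2
      · rw [h2, hf.zero, mul_zero] at h
        exact absurd h (lt_irrefl _)
    · exact absurd h (lt_irrefl _)
  · intro h
    rw [if_pos h.le]
    exact mul_pos hn (hf.pos _ ⟨hmem.1, h⟩)

theorem frontier_positivitySet_symmetricSolution {c : ℝ} {f : ℝ → ℝ} {φ₀ : ℝ}
    (hf : IsSymmetricProfile c f φ₀) :
    frontier (positivitySet (symmetricSolution f φ₀)) = {x | ‖x‖ * Real.cos φ₀ = x 2} := by
  obtain ⟨h0, hpi⟩ := hf.mem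
  have hs := Real.sin_pos_of_pos_of_lt_pi h0 hpi
  have hsc := Real.sin_sq_add_cos_sq φ₀
  have hc1 : Real.cos φ₀ < 1 := by nlinarith
  have hc2 : -1 < Real.cos φ₀ := by nlinarith
  have hcont : Continuous fun x : E3 => ‖x‖ * Real.cos φ₀ := by fun_prop
  have hcont2 : Continuous fun x : E3 => x 2 := by fun_prop
  rw [positivitySet_symmetricSolution hf]
  apply Subset.antisymm (frontier_lt_subset_eq hcont hcont2)
  intro x hx
  rw [(isOpen_lt hcont hcont2).frontier_eq]
  refine ⟨?_, fun h => absurd h (by simpa using hx.ge)⟩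
  have hx' : ‖x‖ * Real.cos φ₀ = x 2 := hx
  rw [Metric.mem_closure_iff]
  intro ε hε
  have hE : ‖(EuclideanSpace.single (2 : Fin 3) (ε / 2) : E3)‖ = ε / 2 := by
    simp [abs_of_pos hε]
  refine ⟨x + EuclideanSpace.single 2 (ε / 2), ?_, ?_⟩
  · have hu := norm_add_le x (EuclideanSpace.single 2 (ε / 2))
    have hl := norm_sub_le (x + EuclideanSpace.single 2 (ε / 2)) (EuclideanSpace.single 2 (ε / 2))
    rw [add_sub_cancel_right] at hl
    rw [hE] at hu hl
    simp only [mem_ofPred_eq, PiLp.add_apply, PiLp.single_apply, if_true]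
    rw [← hx']
    rcases le_total 0 (Real.cos φ₀) with h | h <;> nlinarith
  · rw [dist_eq_norm, sub_add_cancel_left, norm_neg, hE]
    linarith

theorem norm_conicalSurface (φ₀ θ : ℝ) {r : ℝ} (hr : 0 < r) : ‖conicalSurface φ₀ r θ‖ = r := by
  have h : ‖conicalSurface φ₀ r θ‖ ^ 2 = r ^ 2 := by
    rw [EuclideanSpace.real_norm_sq_eq, Fin.sum_univ_three]
    simp only [conicalSurface, PiLp.toLp_apply, Matrix.cons_val]
    linear_combination (r ^ 2 * Real.sin φ₀ ^ 2) * Real.sin_sq_add_cos_sq θ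
      + r ^ 2 * Real.sin_sq_add_cos_sq φ₀
  exact (sq_eq_sq₀ (norm_nonneg _) hr.le).mp h

/-- The parameters `(r, θ)` run through the whole free boundary without the vertex, once. -/
theorem conicalSurface_bijOn {c : ℝ} {f : ℝ → ℝ} {φ₀ : ℝ} (hf : IsSymmetricProfile c f φ₀) :
    BijOn (fun p : ℝ × ℝ => conicalSurface φ₀ p.1 p.2) parameterDomain
      (frontier (positivitySet (symmetricSolution f φ₀)) \ {0}) := by
  rw [frontier_positivitySet_symmetricSolution hf]
  obtain ⟨h0, hpi⟩ := hf.mem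
  have hs := Real.sin_pos_of_pos_of_lt_pi h0 hpi
  refine ⟨?_, ?_, ?_⟩
  · rintro ⟨r, θ⟩ ⟨hr, -⟩
    have hr' : 0 < r := hr
    have hn := norm_conicalSurface φ₀ θ hr'
    refine ⟨?_, fun h => ?_⟩
    · change ‖conicalSurface φ₀ r θ‖ * Real.cos φ₀ = _
      rw [hn]
      simp [conicalSurface]
    · have h' : conicalSurface φ₀ r θ = 0 := h
      rw [h', norm_zero] at hn
      linarith
  · rintro ⟨r, θ⟩ ⟨hr, hθ⟩ ⟨r', θ'⟩ ⟨hr', hθ'⟩ h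
    have h' : conicalSurface φ₀ r θ = conicalSurface φ₀ r' θ' := h
    have hrpos : 0 < r := hr
    obtain rfl : r = r' := by
      have n1 := norm_conicalSurface φ₀ θ hrpos
      rw [h'] at n1
      exact n1.symm.trans (norm_conicalSurface φ₀ θ' hr')
    have e0 := congrArg (fun x : E3 => x 0) h'
    have e1 := congrArg (fun x : E3 => x 1) h'
    simp only [conicalSurface, PiLp.toLp_apply, Matrix.cons_val] at e0 e1
    have c0 : Real.cos θ = Real.cos θ' :=
      mul_left_cancel₀ hrpos.ne' (mul_right_cancel₀ hs.ne' e0)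
    have c1 : Real.sin θ = Real.sin θ' :=
      mul_left_cancel₀ hrpos.ne' (mul_right_cancel₀ hs.ne' e1)
    have a1 := Complex.arg_cos_add_sin_mul_I hθ
    have a2 := Complex.arg_cos_add_sin_mul_I hθ'
    rw [← Complex.ofReal_cos, ← Complex.ofReal_sin] at a1 a2
    rw [c0, c1, a2] at a1
    exact Prod.ext rfl a1.symm
  · rintro x ⟨hx, hx0⟩
    have hx' : ‖x‖ * Real.cos φ₀ = x 2 := hx
    have hn : 0 < ‖x‖ := norm_pos_iff.mpr hx0
    have hsq : ‖x‖ ^ 2 = x 0 ^ 2 + x 1 ^ 2 + x 2 ^ 2 := by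
      rw [EuclideanSpace.real_norm_sq_eq, Fin.sum_univ_three]
    set w : ℂ := ⟨x 0, x 1⟩ with hw
    have hwn : ‖w‖ = ‖x‖ * Real.sin φ₀ := by
      have : ‖w‖ ^ 2 = (‖x‖ * Real.sin φ₀) ^ 2 := by
        rw [← Complex.normSq_eq_norm_sq, Complex.normSq_mk]
        have h1 : x 2 ^ 2 = (‖x‖ * Real.cos φ₀) ^ 2 := by rw [hx']
        linear_combination -hsq - h1 - ‖x‖ ^ 2 * Real.sin_sq_add_cos_sq φ₀
      exact (sq_eq_sq₀ (norm_nonneg _) (by positivity)).mp this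
    refine ⟨(‖x‖, w.arg), ⟨hn, Complex.arg_mem_Ioc w⟩, ?_⟩
    have g0 : ‖w‖ * Real.cos w.arg = x 0 := Complex.norm_mul_cos_arg w
    have g1 : ‖w‖ * Real.sin w.arg = x 1 := Complex.norm_mul_sin_arg w
    rw [hwn] at g0 g1
    ext i
    fin_cases i
    · simp [conicalSurface]; linarith
    · simp [conicalSurface]; linarith
    · simpa [conicalSurface] using hx'

end OnePhaseCone

end

open OnePhaseCone

/-!
In spherical coordinates the positivity set `Γ` is the circular cone `φ < φ₀`. Its boundary has mean
curvature `H = -cot φ₀ / r` (`meanCurvature_conicalSurface`), and the energy density is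
`F_r² / (1 + c²) + F_φ² / r² + F_θ² / (r sin φ)²` (`energyDensity_conicalSurface`). So the stability
inequality reads
`-cos φ₀ ∫∫ F(r, φ₀, θ)² dr dθ ≤ ∫∫∫ (r² F_r² / (1 + c²) + F_φ² + F_θ² / sin² φ) sin φ`,
and it separates.

If `H₁ ≤ g'(φ₀) / g(φ₀)`, drop `F_θ` and apply Hardy's inequality `∫ r² F_r² dr ≥ ∫ F² / 4 dr` on each
ray (`hardy_inequality`). What is left on each arc is the energy
`∫ (v'² + v² / (4 (1 + c²))) sin φ dφ`. The equation of `g` is its Euler-Lagrange equation, so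
the positive solution `g` bounds it below by `sin φ₀ (g'(φ₀) / g(φ₀)) v(φ₀)²`, through the total
derivative of `sin φ (g' / g) v²` (`IsRegularSolution.boundary_le_integral`). The contribution of the
pole vanishes because regularity of `g` forces `sin φ g' → 0` (`IsRegularSolution.tendsto_flux`).

Conversely, both inequalities are sharp: the extremal function is `r^{-1/2} g(φ)`. It is cut off in
`log r` at a scale `1 / ε → ∞`, which costs nothing in the limit (`StabilityInequality.polynomial`).
Smoothness of `g(φ)` as a function on `ℝ³` is not needed at the axis: `g` is replaced by polynomials
`p (cos φ)`, which are smooth away from the vertex. As `g' / sin φ` extends continuously to the pole,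
Weierstrass approximation of `dg / d(cos φ)` gives polynomials close to `g` in the energy
(`IsRegularSolution.nonneg_of_forall_polynomial`).
-/

open Set MeasureTheory Filter Topology
open scoped ContDiff

namespace OnePhaseCone

/-! ### Spherical coordinates -/

/-- The identification of `ℝ³` with triples grouped as `((v₀, v₁), v₂)`. -/
noncomputable def finThreeEquivProd : (Fin 3 → ℝ) ≃ᵐ (ℝ × ℝ) × ℝ :=
  ((MeasurableEquiv.piFinSuccAbove (fun _ => ℝ) 2).trans
    (MeasurableEquiv.prodCongr (MeasurableEquiv.refl ℝ) MeasurableEquiv.finTwoArrow)).trans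
      MeasurableEquiv.prodComm

theorem measurePreserving_finThreeEquivProd : MeasurePreserving finThreeEquivProd := by
  refine MeasurePreserving.comp (g := Prod.swap) Measure.measurePreserving_swap ?_
  exact ((MeasurePreserving.id volume).prod (volume_preserving_finTwoArrow ℝ)).comp
    (volume_preserving_piFinSuccAbove (fun _ => ℝ) 2)

/-- The open circular cone `{φ < φ₀}` about the positive third axis. -/
def circularCone (φ₀ : ℝ) : Set E3 := {x | ‖x‖ * Real.cos φ₀ < x 2}

/-- Spherical coordinates `((r, θ), φ) ↦ x`. -/
noncomputable def spherical (q : (ℝ × ℝ) × ℝ) : E3 := conicalSurface q.2 q.1.1 q.1.2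

theorem conicalSurface_zero (φ r θ : ℝ) :
    conicalSurface φ r θ 0 = r * Real.cos θ * Real.sin φ := rfl

theorem conicalSurface_one (φ r θ : ℝ) :
    conicalSurface φ r θ 1 = r * Real.sin θ * Real.sin φ := rfl

theorem conicalSurface_two (φ r θ : ℝ) : conicalSurface φ r θ 2 = r * Real.cos φ := rfl

theorem injOn_spherical {φ₀ : ℝ} (hφ₀ : φ₀ ≤ Real.pi) :
    InjOn spherical (parameterDomain ×ˢ Ioo 0 φ₀) := by
  rintro ⟨⟨r, θ⟩, φ⟩ ⟨⟨hr, hθ⟩, hφ⟩ ⟨⟨r', θ'⟩, φ'⟩ ⟨⟨hr', hθ'⟩, hφ'⟩ h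
  have h' : conicalSurface φ r θ = conicalSurface φ' r' θ' := h
  have hrpos : 0 < r := hr
  have hrpos' : 0 < r' := hr'
  simp only at hφ hφ' hθ hθ'
  obtain rfl : r = r' := by
    rw [← norm_conicalSurface φ θ hrpos, h', norm_conicalSurface φ' θ' hrpos']
  have e0 := congrArg (fun x : E3 => x 0) h'
  have e1 := congrArg (fun x : E3 => x 1) h'
  have e2 := congrArg (fun x : E3 => x 2) h'
  simp only [conicalSurface_zero, conicalSurface_one, conicalSurface_two] at e0 e1 e2
  obtain rfl : φ = φ' :=
    Real.injOn_cos ⟨hφ.1.le, hφ.2.le.trans hφ₀⟩ ⟨hφ'.1.le, hφ'.2.le.trans hφ₀⟩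
      (mul_left_cancel₀ hrpos.ne' e2)
  have hs := Real.sin_pos_of_pos_of_lt_pi hφ.1 (hφ.2.trans_le hφ₀)
  have c0 : Real.cos θ = Real.cos θ' :=
    mul_left_cancel₀ hrpos.ne' (mul_right_cancel₀ hs.ne' e0)
  have c1 : Real.sin θ = Real.sin θ' :=
    mul_left_cancel₀ hrpos.ne' (mul_right_cancel₀ hs.ne' e1)
  have a1 := Complex.arg_cos_add_sin_mul_I hθ
  have a2 := Complex.arg_cos_add_sin_mul_I hθ'
  rw [← Complex.ofReal_cos, ← Complex.ofReal_sin] at a1 a2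
  rw [c0, c1, a2] at a1
  rw [a1]

/-- Every point off the axis has spherical coordinates. -/
theorem exists_spherical_eq {x : E3} (hx : x 0 ≠ 0 ∨ x 1 ≠ 0) :
    ∃ q ∈ parameterDomain ×ˢ Ioo 0 Real.pi, spherical q = x := by
  have hx0 : x ≠ 0 := by rintro rfl; simp at hx
  have hn : 0 < ‖x‖ := norm_pos_iff.mpr hx0
  have hsq : ‖x‖ ^ 2 = x 0 ^ 2 + x 1 ^ 2 + x 2 ^ 2 := by
    rw [EuclideanSpace.real_norm_sq_eq, Fin.sum_univ_three]
  have hpos : 0 < x 0 ^ 2 + x 1 ^ 2 := by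
    rcases hx with h | h <;> positivity
  have hlt : |x 2| < ‖x‖ := by
    apply abs_lt_of_sq_lt_sq _ hn.le
    linarith
  have hlt' := abs_lt.mp hlt
  have h1 : -1 < x 2 / ‖x‖ := by rw [lt_div_iff₀ hn]; linarith
  have h2 : x 2 / ‖x‖ < 1 := by rw [div_lt_iff₀ hn]; linarith
  have hcos : Real.cos (polarAngle x) = x 2 / ‖x‖ := Real.cos_arccos h1.le h2.le
  have hφ : polarAngle x ∈ Ioo 0 Real.pi :=
    ⟨Real.arccos_pos.mpr h2, Real.arccos_lt_pi.mpr h1⟩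
  set w : ℂ := ⟨x 0, x 1⟩ with hw
  have hs := Real.sin_pos_of_pos_of_lt_pi hφ.1 hφ.2
  have hx2 : ‖x‖ * Real.cos (polarAngle x) = x 2 := by rw [hcos]; field_simp
  have hwn : ‖w‖ = ‖x‖ * Real.sin (polarAngle x) := by
    have : ‖w‖ ^ 2 = (‖x‖ * Real.sin (polarAngle x)) ^ 2 := by
      rw [← Complex.normSq_eq_norm_sq, Complex.normSq_mk]
      have h1 : x 2 ^ 2 = (‖x‖ * Real.cos (polarAngle x)) ^ 2 := by rw [hx2]
      linear_combination -hsq - h1 - ‖x‖ ^ 2 * Real.sin_sq_add_cos_sq (polarAngle x)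
    exact (sq_eq_sq₀ (norm_nonneg _) (by positivity)).mp this
  refine ⟨((‖x‖, w.arg), polarAngle x), ⟨⟨hn, Complex.arg_mem_Ioc w⟩, hφ⟩, ?_⟩
  have g0 : ‖w‖ * Real.cos w.arg = x 0 := Complex.norm_mul_cos_arg w
  have g1 : ‖w‖ * Real.sin w.arg = x 1 := Complex.norm_mul_sin_arg w
  rw [hwn] at g0 g1
  ext i
  fin_cases i
  · change ‖x‖ * Real.cos w.arg * Real.sin (polarAngle x) = x 0
    linarith
  · change ‖x‖ * Real.sin w.arg * Real.sin (polarAngle x) = x 1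
    linarith
  · exact hx2

theorem spherical_mem_cone_iff {φ₀ : ℝ} (hφ₀ : φ₀ ∈ Ioo 0 Real.pi) {q : (ℝ × ℝ) × ℝ}
    (hr : 0 < q.1.1) (hq : q.2 ∈ Icc 0 Real.pi) :
    spherical q ∈ circularCone φ₀ ↔ q.2 < φ₀ := by
  change ‖conicalSurface q.2 q.1.1 q.1.2‖ * _ < q.1.1 * Real.cos q.2 ↔ _
  rw [norm_conicalSurface _ _ hr, mul_lt_mul_iff_right₀ hr]
  exact Real.strictAntiOn_cos.lt_iff_gt ⟨hφ₀.1.le, hφ₀.2.le⟩ hq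

/-- The Jacobian matrix of spherical coordinates, in the order `(r, θ, φ)`. -/
noncomputable def sphericalJacobian (v : Fin 3 → ℝ) : Matrix (Fin 3) (Fin 3) ℝ :=
  !![Real.cos (v 1) * Real.sin (v 2), -(v 0 * Real.sin (v 1) * Real.sin (v 2)),
      v 0 * Real.cos (v 1) * Real.cos (v 2);
    Real.sin (v 1) * Real.sin (v 2), v 0 * Real.cos (v 1) * Real.sin (v 2),
      v 0 * Real.sin (v 1) * Real.cos (v 2);
    Real.cos (v 2), 0, -(v 0 * Real.sin (v 2))]

theorem det_sphericalJacobian (v : Fin 3 → ℝ) :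
    (sphericalJacobian v).det = -(v 0 ^ 2 * Real.sin (v 2)) := by
  rw [sphericalJacobian, Matrix.det_fin_three]
  simp only [Matrix.of_apply, Matrix.cons_val]
  have h1 := Real.sin_sq_add_cos_sq (v 1)
  have h2 := Real.sin_sq_add_cos_sq (v 2)
  have h1' : Real.sin (v 1) ^ 2 = 1 - Real.cos (v 1) ^ 2 := by linarith
  have h2' : Real.sin (v 2) ^ 3 = Real.sin (v 2) * (1 - Real.cos (v 2) ^ 2) := by
    rw [← h2]; ring
  ring_nf
  simp only [h1', h2']
  ring

theorem hasFDerivAt_spherical_pi (v : Fin 3 → ℝ) :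
    HasFDerivAt (fun v : Fin 3 → ℝ => WithLp.ofLp (conicalSurface (v 2) (v 0) (v 1)))
      (LinearMap.toContinuousLinearMap (Matrix.toLin' (sphericalJacobian v))) v := by
  have p (i : Fin 3) : HasFDerivAt (fun v : Fin 3 → ℝ => v i)
      (ContinuousLinearMap.proj (R := ℝ) (φ := fun _ : Fin 3 => ℝ) i) v := hasFDerivAt_apply i v
  rw [hasFDerivAt_pi']
  intro i
  fin_cases i
  · refine (((p 0).mul (p 1).cos).mul (p 2).sin).congr_fderiv ?_
    ext w
    simp [sphericalJacobian, dotProduct, Fin.sum_univ_three]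
    ring
  · refine (((p 0).mul (p 1).sin).mul (p 2).sin).congr_fderiv ?_
    ext w
    simp [sphericalJacobian, dotProduct, Fin.sum_univ_three]
    ring
  · refine ((p 0).mul (p 2).cos).congr_fderiv ?_
    ext w
    simp [sphericalJacobian, dotProduct, Fin.sum_univ_three]
    ring

theorem measurableSet_parameterDomain_prod (φ₀ : ℝ) :
    MeasurableSet (parameterDomain ×ˢ Ioo 0 φ₀) :=
  (measurableSet_Ioi.prod measurableSet_Ioc).prod measurableSet_Ioo

/-- Integration over a circular cone in spherical coordinates. -/
theorem integral_cone {φ₀ : ℝ} (hφ₀ : φ₀ ∈ Ioo 0 Real.pi) (h : E3 → ℝ) :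
    ∫ x in circularCone φ₀, h x =
      ∫ q in parameterDomain ×ˢ Ioo 0 φ₀, q.1.1 ^ 2 * Real.sin q.2 * h (spherical q) := by
  set S := parameterDomain ×ˢ Ioo 0 φ₀ with hS
  have hSm : MeasurableSet S := measurableSet_parameterDomain_prod φ₀
  set f : (Fin 3 → ℝ) → (Fin 3 → ℝ) :=
    fun v => WithLp.ofLp (conicalSurface (v 2) (v 0) (v 1)) with hf
  set T : Set (Fin 3 → ℝ) := finThreeEquivProd ⁻¹' S with hT
  have hTm : MeasurableSet T := finThreeEquivProd.measurable hSm
  have hinj : InjOn f T := by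
    intro v hv w hw hvw
    apply finThreeEquivProd.injective
    exact injOn_spherical hφ₀.2.le hv hw (WithLp.ofLp_injective 2 hvw)
  have hcv := integral_image_eq_integral_abs_det_fderiv_smul volume hTm
    (fun v _ => (hasFDerivAt_spherical_pi v).hasFDerivWithinAt) hinj
    (fun v => h (WithLp.toLp 2 v))
  rw [← (PiLp.volume_preserving_toLp (Fin 3)).setIntegral_preimage_emb
    (MeasurableEquiv.toLp 2 (Fin 3 → ℝ)).measurableEmbedding]
  have hae : (WithLp.toLp 2 ⁻¹' circularCone φ₀ : Set (Fin 3 → ℝ))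
      =ᵐ[volume] f '' T := by
    have hsub : f '' T ⊆ WithLp.toLp 2 ⁻¹' circularCone φ₀ := by
      rintro _ ⟨v, hv, rfl⟩
      have hv' : finThreeEquivProd v ∈ S := hv
      exact (spherical_mem_cone_iff hφ₀ hv'.1.1
        ⟨hv'.2.1.le, hv'.2.2.le.trans hφ₀.2.le⟩).mpr hv'.2.2
    refine (hsub.eventuallyLE.antisymm ?_).symm
    -- spherical coordinates miss only the axis, which lies in the null set `v 0 = 0`
    have hnull : volume {v : Fin 3 → ℝ | v 0 = 0} = 0 := Measure.pi_hyperplane _ 0 0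
    rw [ae_le_set]
    refine measure_mono_null (fun v hv => ?_) hnull
    by_contra h0
    apply hv.2
    obtain ⟨q, hq, hqv⟩ := exists_spherical_eq (x := WithLp.toLp 2 v) (Or.inl h0)
    refine ⟨finThreeEquivProd.symm q, ?_, ?_⟩
    · change finThreeEquivProd (finThreeEquivProd.symm q) ∈ S
      rw [MeasurableEquiv.apply_symm_apply]
      refine ⟨hq.1, hq.2.1, ?_⟩
      have : WithLp.toLp 2 v ∈ circularCone φ₀ := hv.1
      rw [← hqv] at this
      exact (spherical_mem_cone_iff hφ₀ hq.1.1 ⟨hq.2.1.le, hq.2.2.le⟩).mp this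
    · have : spherical (finThreeEquivProd (finThreeEquivProd.symm q)) = WithLp.toLp 2 v := by
        rw [MeasurableEquiv.apply_symm_apply, hqv]
      exact congrArg WithLp.ofLp this
  rw [setIntegral_congr_set hae, hcv, ← measurePreserving_finThreeEquivProd.setIntegral_preimage_emb
    finThreeEquivProd.measurableEmbedding]
  refine setIntegral_congr_fun hTm fun v hv => ?_
  have hv' : finThreeEquivProd v ∈ S := hv
  have hsin : 0 < Real.sin (v 2) :=
    Real.sin_pos_of_pos_of_lt_pi hv'.2.1 (hv'.2.2.trans hφ₀.2)
  have hdet : |(LinearMap.toContinuousLinearMap (Matrix.toLin' (sphericalJacobian v))).det| =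
      v 0 ^ 2 * Real.sin (v 2) := by
    rw [ContinuousLinearMap.det, LinearMap.coe_toContinuousLinearMap, LinearMap.det_toLin',
      det_sphericalJacobian, abs_neg, abs_of_pos]
    have : 0 < v 0 := hv'.1.1
    positivity
  simp only [hdet, smul_eq_mul]
  rfl

/-! ### The spherical frame, the mean curvature and the energy density -/

/-- The unit vector in the direction of increasing longitude `θ`. -/
noncomputable def longitudeDir (θ : ℝ) : E3 := !₂[-Real.sin θ, Real.cos θ, 0]

/-- The unit vector in the direction of increasing polar angle `φ`. -/
noncomputable def polarDir (φ θ : ℝ) : E3 :=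
  !₂[Real.cos θ * Real.cos φ, Real.sin θ * Real.cos φ, -Real.sin φ]

theorem hasDerivAt_toLp_three {a b d : ℝ → ℝ} {a' b' d' t : ℝ} (ha : HasDerivAt a a' t)
    (hb : HasDerivAt b b' t) (hd : HasDerivAt d d' t) :
    HasDerivAt (fun t => (!₂[a t, b t, d t] : E3)) !₂[a', b', d'] t := by
  have h : HasDerivAt (fun t => ![a t, b t, d t]) ![a', b', d'] t := by
    rw [hasDerivAt_pi]
    intro i
    fin_cases i
    exacts [ha, hb, hd]
  exact (PiLp.continuousLinearEquiv 2 ℝ (fun _ : Fin 3 => ℝ)).symm.hasFDerivAt.comp_hasDerivAt t h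

theorem hasDerivAt_conicalSurface_radius (φ r θ : ℝ) :
    HasDerivAt (fun a => conicalSurface φ a θ) (conicalSurface φ 1 θ) r := by
  have h := hasDerivAt_id r
  exact hasDerivAt_toLp_three ((h.mul_const _).mul_const _) ((h.mul_const _).mul_const _)
    (h.mul_const _)

theorem hasDerivAt_conicalSurface_longitude (φ r θ : ℝ) :
    HasDerivAt (fun b => conicalSurface φ r b) ((r * Real.sin φ) • longitudeDir θ) θ := by
  refine (hasDerivAt_toLp_three (((Real.hasDerivAt_cos θ).const_mul r).mul_const (Real.sin φ))
    (((Real.hasDerivAt_sin θ).const_mul r).mul_const (Real.sin φ))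
    (hasDerivAt_const θ (r * Real.cos φ))).congr_deriv ?_
  ext i
  fin_cases i <;> simp [longitudeDir] <;> ring

theorem hasDerivAt_conicalSurface_polar (φ r θ : ℝ) :
    HasDerivAt (fun p => conicalSurface p r θ) (r • polarDir φ θ) φ := by
  refine (hasDerivAt_toLp_three ((Real.hasDerivAt_sin φ).const_mul (r * Real.cos θ))
    ((Real.hasDerivAt_sin φ).const_mul (r * Real.sin θ))
    ((Real.hasDerivAt_cos φ).const_mul r)).congr_deriv ?_
  ext i
  fin_cases i <;> simp [polarDir] <;> ring

theorem hasDerivAt_longitudeDir (θ : ℝ) :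
    HasDerivAt longitudeDir !₂[-Real.cos θ, -Real.sin θ, 0] θ :=
  hasDerivAt_toLp_three (Real.hasDerivAt_sin θ).neg (Real.hasDerivAt_cos θ) (hasDerivAt_const θ 0)

theorem inner_toLp_three (a b d a' b' d' : ℝ) :
    inner ℝ (!₂[a, b, d] : E3) !₂[a', b', d'] = a * a' + b * b' + d * d' := by
  simp [PiLp.inner_apply, Fin.sum_univ_three]
  ring

theorem inner_radius_radius (φ θ : ℝ) :
    inner ℝ (conicalSurface φ 1 θ) (conicalSurface φ 1 θ) = 1 := by
  rw [real_inner_self_eq_norm_sq, norm_conicalSurface φ θ one_pos, one_pow]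

theorem inner_radius_longitude (φ θ : ℝ) :
    inner ℝ (conicalSurface φ 1 θ) (longitudeDir θ) = 0 := by
  rw [conicalSurface, longitudeDir, inner_toLp_three]
  ring

theorem inner_longitude_longitude (θ : ℝ) :
    inner ℝ (longitudeDir θ) (longitudeDir θ) = 1 := by
  rw [longitudeDir, inner_toLp_three]
  linear_combination Real.sin_sq_add_cos_sq θ

theorem inner_polar_polar (φ θ : ℝ) : inner ℝ (polarDir φ θ) (polarDir φ θ) = 1 := by
  rw [polarDir, inner_toLp_three]
  linear_combination Real.cos φ ^ 2 * Real.sin_sq_add_cos_sq θ + Real.sin_sq_add_cos_sq φ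

theorem areaElement_conicalSurface {φ r : ℝ} (hφ : φ ∈ Ioo 0 Real.pi) (hr : 0 < r) (θ : ℝ) :
    areaElement (conicalSurface φ) r θ = r * Real.sin φ := by
  have hs := Real.sin_pos_of_pos_of_lt_pi hφ.1 hφ.2
  simp only [areaElement, (hasDerivAt_conicalSurface_radius φ r θ).deriv,
    (hasDerivAt_conicalSurface_longitude φ r θ).deriv, inner_smul_left, inner_smul_right,
    inner_radius_radius, inner_radius_longitude, inner_longitude_longitude]
  rw [Real.sqrt_eq_iff_mul_self_eq_of_pos (mul_pos hr hs)]
  simp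

theorem unitNormal_conicalSurface {φ r : ℝ} (hφ : φ ∈ Ioo 0 Real.pi) (hr : 0 < r) (θ : ℝ) :
    unitNormal (conicalSurface φ) r θ = polarDir φ θ := by
  have hs := Real.sin_pos_of_pos_of_lt_pi hφ.1 hφ.2
  have hcross : (WithLp.toLp 2 (crossProduct (WithLp.ofLp ((r * Real.sin φ) • longitudeDir θ))
      (WithLp.ofLp (conicalSurface φ 1 θ))) : E3) = (r * Real.sin φ) • polarDir φ θ := by
    have h1 := Real.sin_sq_add_cos_sq θ
    ext i
    fin_cases i
    · simp [longitudeDir, polarDir, conicalSurface, cross_apply]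
      ring
    · simp [longitudeDir, polarDir, conicalSurface, cross_apply]
      ring
    · simp [longitudeDir, polarDir, conicalSurface, cross_apply]
      linear_combination -(r * Real.sin φ ^ 2) * h1
  have hn : ‖polarDir φ θ‖ = 1 := by
    have := inner_polar_polar φ θ
    rw [real_inner_self_eq_norm_sq] at this
    exact (pow_eq_one_iff_of_nonneg (norm_nonneg _) two_ne_zero).mp this
  simp only [unitNormal, (hasDerivAt_conicalSurface_radius φ r θ).deriv,
    (hasDerivAt_conicalSurface_longitude φ r θ).deriv]
  rw [hcross, norm_smul, hn, mul_one, Real.norm_of_nonneg (mul_pos hr hs).le,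
    inv_smul_smul₀ (mul_pos hr hs).ne']

/-- The mean curvature of the circular cone of half-angle `φ` at distance `r` from the vertex is
`-cot φ / r`. -/
theorem meanCurvature_conicalSurface {φ r : ℝ} (hφ : φ ∈ Ioo 0 Real.pi) (hr : 0 < r) (θ : ℝ) :
    meanCurvature (conicalSurface φ) r θ = -Real.cos φ / (r * Real.sin φ) := by
  have hs := Real.sin_pos_of_pos_of_lt_pi hφ.1 hφ.2
  have hr0 := hr.ne'
  have htt : HasDerivAt (fun b => (r * Real.sin φ) • longitudeDir b)
      ((r * Real.sin φ) • (!₂[-Real.cos θ, -Real.sin θ, 0] : E3)) θ :=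
    (hasDerivAt_longitudeDir θ).fun_const_smul _
  have hn : inner ℝ (!₂[-Real.cos θ, -Real.sin θ, 0] : E3) (polarDir φ θ) = -Real.cos φ := by
    rw [polarDir, inner_toLp_three]
    linear_combination -Real.cos φ * Real.sin_sq_add_cos_sq θ
  simp only [meanCurvature, unitNormal_conicalSurface hφ hr,
    (hasDerivAt_conicalSurface_radius φ _ _).deriv,
    (hasDerivAt_conicalSurface_longitude φ _ _).deriv, htt.deriv, deriv_const, inner_smul_left,
    inner_smul_right, inner_radius_radius, inner_radius_longitude, inner_longitude_longitude, hn,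
    inner_zero_left]
  simp
  field_simp

/-- The energy density in the orthonormal frame of spherical coordinates: the metric of the cone
shrinks only the radial component of the gradient. -/
theorem energyDensity_conicalSurface (c : ℝ) (F : E3 → ℝ) {φ r : ℝ} (hr : 0 < r) (θ : ℝ) :
    energyDensity c F (conicalSurface φ r θ) =
      (fderiv ℝ F (conicalSurface φ r θ) (conicalSurface φ 1 θ)) ^ 2 / (1 + c ^ 2) +
        (fderiv ℝ F (conicalSurface φ r θ) (polarDir φ θ)) ^ 2 +
        (fderiv ℝ F (conicalSurface φ r θ) (longitudeDir θ)) ^ 2 := by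
  set L := fderiv ℝ F (conicalSurface φ r θ) with hL
  have hv (v : E3) : L v = v 0 * L (EuclideanSpace.single 0 1) +
      v 1 * L (EuclideanSpace.single 1 1) + v 2 * L (EuclideanSpace.single 2 1) := by
    have : v = v 0 • EuclideanSpace.single 0 (1 : ℝ) + v 1 • EuclideanSpace.single 1 (1 : ℝ) +
        v 2 • EuclideanSpace.single 2 (1 : ℝ) := by
      ext i
      fin_cases i <;> simp
    conv_lhs => rw [this]
    simp only [map_add, map_smul, smul_eq_mul]
  have hc : (1 + c ^ 2) ≠ 0 := by positivity
  have hr0 := hr.ne'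
  rw [hv (conicalSurface φ 1 θ), hv (polarDir φ θ), hv (longitudeDir θ)]
  simp only [energyDensity, coneInvMetric, ← hL, norm_conicalSurface φ θ hr, Fin.sum_univ_three,
    Matrix.of_apply, conicalSurface_zero, conicalSurface_one, conicalSurface_two, polarDir,
    longitudeDir, PiLp.toLp_apply, Matrix.cons_val]
  simp only [Fin.reduceEq, if_true, if_false, one_mul]
  generalize L (EuclideanSpace.single 0 1) = a
  generalize L (EuclideanSpace.single 1 1) = b
  generalize L (EuclideanSpace.single 2 1) = d
  have h1 : Real.sin θ ^ 2 = 1 - Real.cos θ ^ 2 := by linarith [Real.sin_sq_add_cos_sq θ]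
  have h2 : Real.sin φ ^ 2 = 1 - Real.cos φ ^ 2 := by linarith [Real.sin_sq_add_cos_sq φ]
  field_simp
  ring_nf
  simp only [h1, h2]
  ring

/-! ### The angular profile -/

theorem exists_derivative_eq (q : Polynomial ℝ) :
    ∃ p : Polynomial ℝ, Polynomial.derivative p = q := by
  induction q using Polynomial.induction_on' with
  | add p q hp hq =>
    obtain ⟨a, rfl⟩ := hp
    obtain ⟨b, rfl⟩ := hq
    exact ⟨a + b, Polynomial.derivative_add⟩
  | monomial n a =>
    refine ⟨Polynomial.monomial (n + 1) (a / (n + 1)), ?_⟩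
    rw [Polynomial.derivative_monomial]
    congr 1
    push_cast
    field_simp

/-- The constant `1 / (4 (1 + c²)) = -β (β + 1) / (1 + c²)` for `β = -1/2`. -/
noncomputable def hardyConst (c : ℝ) : ℝ := 1 / (4 * (1 + c ^ 2))

theorem hardyConst_pos (c : ℝ) : 0 < hardyConst c := by
  unfold hardyConst
  positivity

theorem hardyConst_le (c : ℝ) : hardyConst c ≤ 1 / 4 := by
  unfold hardyConst
  apply one_div_le_one_div_of_le (by norm_num)
  nlinarith [sq_nonneg c]

section ODE

variable {c : ℝ} {g : ℝ → ℝ}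

theorem IsRegularSolution.continuousOn (hg : IsRegularSolution c (-1 / 2) g) :
    ContinuousOn g (Ico 0 Real.pi) := by
  intro φ hφ
  rcases hφ.1.eq_or_lt with h | h
  · subst h
    exact hg.deriv_zero.continuousWithinAt.mono fun x hx => hx.1
  · exact (hg.diff φ ⟨h, hφ.2⟩).continuousAt.continuousWithinAt

/-- The equation in divergence form, `(sin φ g')' = sin φ g / (4 (1 + c²))`. -/
theorem IsRegularSolution.hasDerivAt_flux (hg : IsRegularSolution c (-1 / 2) g) {φ : ℝ}
    (hφ : φ ∈ Ioo 0 Real.pi) :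
    HasDerivAt (fun φ => Real.sin φ * deriv g φ) (hardyConst c * Real.sin φ * g φ) φ := by
  refine ((Real.hasDerivAt_sin φ).mul (hg.diff_deriv φ hφ).hasDerivAt).congr_deriv ?_
  have hs := (Real.sin_pos_of_pos_of_lt_pi hφ.1 hφ.2).ne'
  have hode := hg.ode φ hφ
  have hc : (1 + c ^ 2) ≠ 0 := by positivity
  unfold hardyConst
  field_simp at hode ⊢
  linear_combination hode

theorem IsRegularSolution.monotoneOn_flux (hg : IsRegularSolution c (-1 / 2) g)
    (hpos : ∀ φ ∈ Ico 0 Real.pi, 0 < g φ) :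
    MonotoneOn (fun φ => Real.sin φ * deriv g φ) (Ioo 0 Real.pi) := by
  refine monotoneOn_of_deriv_nonneg (convex_Ioo _ _)
    (fun φ hφ => (hg.hasDerivAt_flux hφ).continuousAt.continuousWithinAt) ?_ ?_
  · rw [interior_Ioo]
    exact fun φ hφ => (hg.hasDerivAt_flux hφ).differentiableAt.differentiableWithinAt
  · rw [interior_Ioo]
    intro φ hφ
    rw [(hg.hasDerivAt_flux hφ).deriv]
    have := hpos φ ⟨hφ.1.le, hφ.2⟩
    have := Real.sin_pos_of_pos_of_lt_pi hφ.1 hφ.2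
    have := hardyConst_pos c
    positivity

/-- Regularity at the pole: the flux `sin φ g'` vanishes there. It is monotone, and by the mean
value theorem `g'` is small at points arbitrarily close to `0`. -/
theorem IsRegularSolution.tendsto_flux (hg : IsRegularSolution c (-1 / 2) g)
    (hpos : ∀ φ ∈ Ico 0 Real.pi, 0 < g φ) :
    Tendsto (fun φ => Real.sin φ * deriv g φ) (𝓝[>] 0) (𝓝 0) := by
  have hmono := hg.monotoneOn_flux hpos
  -- mean value theorem on `[0, x]` for small `x`, as `(g x - g 0) / x → 0`
  have hsmall : ∀ ε > 0, ∀ δ ∈ Ioo 0 Real.pi, ∃ ξ ∈ Ioo 0 δ, |Real.sin ξ * deriv g ξ| < ε := by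
    intro ε hε δ hδ
    have hsl := (hasDerivWithinAt_iff_tendsto_slope' self_notMem_Ioi).mp hg.deriv_zero.Ioi_of_Ici
    have hev := (Metric.tendsto_nhds.mp hsl ε hε).and (Ioo_mem_nhdsGT hδ.1)
    obtain ⟨x, hx, hx0⟩ := hev.exists
    obtain ⟨ξ, hξ, hξe⟩ := exists_deriv_eq_slope g hx0.1
      (hg.continuousOn.mono fun y hy => ⟨hy.1, hy.2.trans_lt (hx0.2.trans hδ.2)⟩)
      (fun y hy => (hg.diff y ⟨hy.1, hy.2.trans (hx0.2.trans hδ.2)⟩).differentiableWithinAt)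
    refine ⟨ξ, ⟨hξ.1, hξ.2.trans hx0.2⟩, ?_⟩
    rw [slope_def_field, ← hξe, dist_zero_right, Real.norm_eq_abs] at hx
    rw [abs_mul]
    exact (mul_le_of_le_one_left (abs_nonneg _) (Real.abs_sin_le_one ξ)).trans_lt hx
  have hnonneg : ∀ φ ∈ Ioo 0 Real.pi, 0 ≤ Real.sin φ * deriv g φ := by
    intro φ hφ
    by_contra! hneg
    obtain ⟨ξ, hξ, hξ'⟩ := hsmall (-(Real.sin φ * deriv g φ)) (by linarith) φ hφ
    have := hmono ⟨hξ.1, hξ.2.trans hφ.2⟩ hφ hξ.2.le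
    have := (abs_lt.mp hξ').1
    simp only at *
    linarith
  rw [Metric.tendsto_nhds]
  intro ε hε
  obtain ⟨ξ, hξ, hξ'⟩ := hsmall ε hε 1 ⟨one_pos, by linarith [Real.pi_gt_three]⟩
  have hξπ : ξ ∈ Ioo 0 Real.pi := ⟨hξ.1, by linarith [Real.pi_gt_three, hξ.2]⟩
  filter_upwards [Ioo_mem_nhdsGT hξ.1] with φ hφ
  have hφπ : φ ∈ Ioo 0 Real.pi := ⟨hφ.1, hφ.2.trans hξπ.2⟩
  rw [dist_zero_right, Real.norm_of_nonneg (hnonneg φ hφπ)]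
  exact (hmono hφπ hξπ hφ.2.le).trans_lt ((le_abs_self _).trans_lt hξ')

theorem IsRegularSolution.continuousOn_flux (hg : IsRegularSolution c (-1 / 2) g)
    (hpos : ∀ φ ∈ Ico 0 Real.pi, 0 < g φ)
    {φ₀ : ℝ} (hφ₀ : φ₀ < Real.pi) :
    ContinuousOn (fun φ => Real.sin φ * deriv g φ) (Icc 0 φ₀) := by
  intro φ hφ
  rcases hφ.1.eq_or_lt with h | h
  · subst h
    have h0 : Tendsto (fun φ => Real.sin φ * deriv g φ) (𝓝[>] 0)
        (𝓝 (Real.sin 0 * deriv g 0)) := by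
      rw [Real.sin_zero, zero_mul]
      exact hg.tendsto_flux hpos
    exact (continuousWithinAt_Ioi_iff_Ici.mp h0).mono fun x hx => hx.1
  · exact (hg.hasDerivAt_flux ⟨h, hφ.2.trans_lt hφ₀⟩).continuousAt.continuousWithinAt

/-- The sharp boundary inequality on `[0, φ₀]`, with equality for `v = g`: the positive solution
`g` gives `(sin φ (g'/g) v²)' ≤ (v'² + v² / (4 (1 + c²))) sin φ`. -/
theorem IsRegularSolution.boundary_le_integral (hg : IsRegularSolution c (-1 / 2) g)
    (hpos : ∀ φ ∈ Ico 0 Real.pi, 0 < g φ)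
    {φ₀ : ℝ} (hφ₀ : φ₀ ∈ Ioo 0 Real.pi) {v v' : ℝ → ℝ}
    (hv : ContinuousOn v (Icc 0 φ₀)) (hv' : ∀ φ ∈ Ioo 0 φ₀, HasDerivAt v (v' φ) φ)
    (hint : IntegrableOn (fun φ => (v' φ ^ 2 + hardyConst c * v φ ^ 2) * Real.sin φ) (Ioo 0 φ₀)) :
    Real.sin φ₀ * (deriv g φ₀ / g φ₀) * v φ₀ ^ 2 ≤
      ∫ φ in Ioo 0 φ₀, (v' φ ^ 2 + hardyConst c * v φ ^ 2) * Real.sin φ := by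
  have hsub : Icc 0 φ₀ ⊆ Ico 0 Real.pi := fun x hx => ⟨hx.1, hx.2.trans_lt hφ₀.2⟩
  have key := intervalIntegral.sub_le_integral_of_hasDeriv_right_of_le hφ₀.1.le
    (g := fun φ => Real.sin φ * deriv g φ * v φ ^ 2 / g φ)
    (g' := fun φ => ((hardyConst c * Real.sin φ * g φ * v φ ^ 2 +
      Real.sin φ * deriv g φ * (2 * v φ * v' φ)) * g φ -
      Real.sin φ * deriv g φ * v φ ^ 2 * deriv g φ) / g φ ^ 2)
    (φ := fun φ => (v' φ ^ 2 + hardyConst c * v φ ^ 2) * Real.sin φ)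
    (((hg.continuousOn_flux hpos hφ₀.2).mul (hv.pow 2)).div (hg.continuousOn.mono hsub)
      fun φ hφ => (hpos φ (hsub hφ)).ne')
    (fun φ hφ => by
      have hφ' : φ ∈ Ioo 0 Real.pi := ⟨hφ.1, hφ.2.trans hφ₀.2⟩
      have h := ((hg.hasDerivAt_flux hφ').mul ((hv' φ hφ).pow 2)).div (hg.diff φ hφ').hasDerivAt
        (hpos φ ⟨hφ.1.le, hφ'.2⟩).ne'
      refine HasDerivAt.hasDerivWithinAt (h.congr_deriv ?_)
      simp only [Pi.mul_apply, Pi.pow_apply]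
      norm_num)
    ((integrableOn_Icc_iff_integrableOn_Ioo).mpr hint)
    (fun φ hφ => by
      have hφ' : φ ∈ Ioo 0 Real.pi := ⟨hφ.1, hφ.2.trans hφ₀.2⟩
      have hgp := hpos φ ⟨hφ.1.le, hφ'.2⟩
      have hs := Real.sin_pos_of_pos_of_lt_pi hφ'.1 hφ'.2
      rw [div_le_iff₀ (by positivity)]
      have : 0 ≤ Real.sin φ * (v' φ * g φ - v φ * deriv g φ) ^ 2 := by positivity
      nlinarith [this])
  rw [intervalIntegral.integral_of_le hφ₀.1.le, integral_Ioc_eq_integral_Ioo] at key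
  simp only [Real.sin_zero, zero_mul, zero_div, sub_zero] at key
  refine le_trans (le_of_eq ?_) key
  ring

/-- The continuous extension of `g' / sin`, that is, of `-dg / d(cos φ)`, to the pole. -/
theorem IsRegularSolution.tendsto_deriv_div_sin (hg : IsRegularSolution c (-1 / 2) g)
    (hpos : ∀ φ ∈ Ico 0 Real.pi, 0 < g φ) :
    Tendsto (fun φ => deriv g φ / Real.sin φ) (𝓝[>] 0) (𝓝 (hardyConst c * g 0 / 2)) := by
  have hI : ∀ᶠ φ : ℝ in 𝓝[>] 0, φ ∈ Ioo 0 1 := Ioo_mem_nhdsGT one_pos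
  have hIπ : ∀ φ ∈ Ioo (0 : ℝ) 1, φ ∈ Ioo 0 Real.pi := fun φ hφ =>
    ⟨hφ.1, by linarith [Real.pi_gt_three, hφ.2]⟩
  have hcos : ∀ φ ∈ Ioo (0 : ℝ) 1, 0 < Real.cos φ := fun φ hφ =>
    Real.cos_pos_of_mem_Ioo ⟨by linarith [Real.pi_gt_three, hφ.1],
      by linarith [Real.pi_gt_three, hφ.2]⟩
  have hsin : ∀ φ ∈ Ioo (0 : ℝ) 1, 0 < Real.sin φ := fun φ hφ =>
    Real.sin_pos_of_pos_of_lt_pi hφ.1 (hIπ φ hφ).2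
  have hlim := HasDerivAt.lhopital_zero_nhdsGT (a := 0)
    (f := fun φ => Real.sin φ * deriv g φ) (f' := fun φ => hardyConst c * Real.sin φ * g φ)
    (g := fun φ => Real.sin φ ^ 2) (g' := fun φ => 2 * Real.sin φ * Real.cos φ)
    (l := 𝓝 (hardyConst c * g 0 / 2))
    (hI.mono fun φ hφ => hg.hasDerivAt_flux (hIπ φ hφ))
    (Eventually.of_forall fun φ => by
      refine ((Real.hasDerivAt_sin φ).pow 2).congr_deriv ?_
      norm_num)
    (hI.mono fun φ hφ => by
      have := hcos φ hφ
      have := hsin φ hφ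
      positivity)
    (hg.tendsto_flux hpos)
    (by
      have : Tendsto (fun φ => Real.sin φ ^ 2) (𝓝[>] 0) (𝓝 (Real.sin 0 ^ 2)) :=
        ((Real.continuous_sin.pow 2).tendsto 0).mono_left nhdsWithin_le_nhds
      simpa using this)
    (by
      have h1 : Tendsto g (𝓝[>] 0) (𝓝 (g 0)) :=
        hg.deriv_zero.continuousWithinAt.mono Ioi_subset_Ici_self
      have h2 : Tendsto Real.cos (𝓝[>] 0) (𝓝 1) := by
        have := (Real.continuous_cos.tendsto 0).mono_left (nhdsWithin_le_nhds (s := Ioi 0))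
        rwa [Real.cos_zero] at this
      have h3 := (h1.const_mul (hardyConst c)).div (h2.const_mul 2) (by norm_num)
      rw [mul_one] at h3
      refine h3.congr' (hI.mono fun φ hφ => ?_)
      have := hcos φ hφ
      have := hsin φ hφ
      simp only [Pi.div_apply]
      field_simp)
  refine hlim.congr' (hI.mono fun φ hφ => ?_)
  have := hsin φ hφ
  field_simp

/-- If the angular energy minus the boundary term is nonnegative on polynomials in `cos φ`, it is
nonnegative on `g`: polynomials in `cos φ` approximate `g` together with its derivative. -/
theorem IsRegularSolution.nonneg_of_forall_polynomial (hg : IsRegularSolution c (-1 / 2) g)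
    (hpos : ∀ φ ∈ Ico 0 Real.pi, 0 < g φ)
    {φ₀ : ℝ} (hφ₀ : φ₀ ∈ Ioo 0 Real.pi)
    (H : ∀ p : Polynomial ℝ, 0 ≤ Real.cos φ₀ * p.eval (Real.cos φ₀) ^ 2 +
      ∫ φ in Ioo 0 φ₀, ((Real.sin φ * (Polynomial.derivative p).eval (Real.cos φ)) ^ 2 +
        hardyConst c * p.eval (Real.cos φ) ^ 2) * Real.sin φ) :
    0 ≤ Real.cos φ₀ * g φ₀ ^ 2 + Real.sin φ₀ * deriv g φ₀ * g φ₀ := by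
  have hsub : Icc 0 φ₀ ⊆ Ico 0 Real.pi := fun x hx => ⟨hx.1, hx.2.trans_lt hφ₀.2⟩
  have hsin : ∀ φ ∈ Ioo 0 φ₀, 0 < Real.sin φ := fun φ hφ =>
    Real.sin_pos_of_pos_of_lt_pi hφ.1 (hφ.2.trans hφ₀.2)
  -- `W` is `g' / sin` with its limit as value at the pole
  obtain ⟨W, hWc, hW⟩ : ∃ W : ℝ → ℝ, ContinuousOn W (Icc 0 φ₀) ∧
      ∀ φ ∈ Ioc 0 φ₀, Real.sin φ * W φ = deriv g φ := by
    refine ⟨Function.update (fun φ => deriv g φ / Real.sin φ) 0 (hardyConst c * g 0 / 2), ?_, ?_⟩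
    · intro φ hφ
      rcases hφ.1.eq_or_lt with h | h
      · subst h
        rw [continuousWithinAt_update_same]
        exact (hg.tendsto_deriv_div_sin hpos).mono_left
          (nhdsWithin_mono _ fun x hx => lt_of_le_of_ne hx.1.1 (Ne.symm hx.2))
      · rw [continuousWithinAt_update_of_ne h.ne']
        have hφ' : φ ∈ Ioo 0 Real.pi := ⟨h, hφ.2.trans_lt hφ₀.2⟩
        exact ((hg.diff_deriv φ hφ').continuousAt.div Real.continuous_sin.continuousAt
          (Real.sin_pos_of_pos_of_lt_pi hφ'.1 hφ'.2).ne').continuousWithinAt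
    · intro φ hφ
      have := Real.sin_pos_of_pos_of_lt_pi hφ.1 (hφ.2.trans_lt hφ₀.2)
      rw [Function.update_of_ne hφ.1.ne']
      field_simp
  have hgc : ContinuousOn g (Icc 0 φ₀) := hg.continuousOn.mono hsub
  have hcontI : ContinuousOn (fun φ => ((Real.sin φ * W φ) ^ 2 + hardyConst c * g φ ^ 2) *
      Real.sin φ) (Icc 0 φ₀) := by fun_prop
  have hI : ∫ φ in Ioo 0 φ₀, ((Real.sin φ * W φ) ^ 2 + hardyConst c * g φ ^ 2) * Real.sin φ =
      Real.sin φ₀ * deriv g φ₀ * g φ₀ := by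
    rw [← integral_Ioc_eq_integral_Ioo, ← intervalIntegral.integral_of_le hφ₀.1.le,
      intervalIntegral.integral_eq_sub_of_hasDerivAt_of_le hφ₀.1.le
        (f := fun φ => Real.sin φ * deriv g φ * g φ)
        ((hg.continuousOn_flux hpos hφ₀.2).mul hgc)]
    · simp
    · intro φ hφ
      have hφ' : φ ∈ Ioo 0 Real.pi := ⟨hφ.1, hφ.2.trans hφ₀.2⟩
      refine ((hg.hasDerivAt_flux hφ').mul (hg.diff φ hφ').hasDerivAt).congr_deriv ?_
      rw [hW φ ⟨hφ.1, hφ.2.le⟩]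
      ring
    · exact (uIcc_of_le hφ₀.1.le ▸ hcontI).intervalIntegrable
  set I := Real.sin φ₀ * deriv g φ₀ * g φ₀ with hIdef
  have hk := hardyConst_pos c
  have hk' := hardyConst_le c
  have hbound : ∀ ε ∈ Ioo (0 : ℝ) 1, 0 ≤ Real.cos φ₀ * g φ₀ ^ 2 + I + ε * (I + 10 * φ₀) := by
    intro ε hε
    -- `q` approximates `W`; the primitive `p` of `-q` with `p (cos φ₀) = g φ₀` has error `ε` in the
    -- derivative of `p (cos φ)` and, integrating from `φ₀`, error `ε φ₀` in its value
    have hWarc : ContinuousOn (fun s => W (Real.arccos s)) (Icc (Real.cos φ₀) 1) := by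
      refine hWc.comp Real.continuous_arccos.continuousOn fun s hs => ⟨Real.arccos_nonneg s, ?_⟩
      calc Real.arccos s ≤ Real.arccos (Real.cos φ₀) := Real.arccos_le_arccos hs.1
        _ = φ₀ := Real.arccos_cos hφ₀.1.le hφ₀.2.le
    obtain ⟨q, hq⟩ := exists_polynomial_near_of_continuousOn _ _ _ hWarc ε hε.1
    have hq' : ∀ φ ∈ Icc 0 φ₀, |q.eval (Real.cos φ) - W φ| ≤ ε := by
      intro φ hφ
      have := hq (Real.cos φ) ⟨Real.cos_le_cos_of_nonneg_of_le_pi hφ.1 hφ₀.2.le hφ.2,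
        Real.cos_le_one φ⟩
      rw [Real.arccos_cos hφ.1 (hφ.2.trans hφ₀.2.le)] at this
      exact this.le
    obtain ⟨p₀, hp₀⟩ := exists_derivative_eq (-q)
    set p := p₀ + Polynomial.C (g φ₀ - p₀.eval (Real.cos φ₀)) with hp
    have hpd : Polynomial.derivative p = -q := by simp [hp, hp₀]
    have hp0 : p.eval (Real.cos φ₀) = g φ₀ := by simp [hp]
    have hD : ∀ φ ∈ Icc 0 φ₀, |p.eval (Real.cos φ) - g φ| ≤ ε * φ₀ := by
      have hmv {x y : ℝ} := Convex.norm_image_sub_le_of_norm_hasDerivWithin_le (𝕜 := ℝ) (C := ε)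
        (f := fun φ => p.eval (Real.cos φ) - g φ)
        (f' := fun φ => Real.sin φ * (q.eval (Real.cos φ) - W φ)) (s := Icc 0 φ₀) (x := x) (y := y)
        (fun φ hφ => by
          have h1 : HasDerivAt (fun φ => p.eval (Real.cos φ))
              (Real.sin φ * q.eval (Real.cos φ)) φ := by
            refine ((p.hasDerivAt (Real.cos φ)).comp φ (Real.hasDerivAt_cos φ)).congr_deriv ?_
            rw [hpd, Polynomial.eval_neg]
            ring
          rcases hφ.1.eq_or_lt with h | h
          · subst h
            refine (h1.hasDerivWithinAt.sub (hg.deriv_zero.mono Icc_subset_Ici_self)).congr_deriv ?_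
            simp
          · refine (h1.sub (hg.diff φ ⟨h, hφ.2.trans_lt hφ₀.2⟩).hasDerivAt).hasDerivWithinAt
              |>.congr_deriv ?_
            rw [← hW φ ⟨h, hφ.2⟩]
            ring)
        (fun φ hφ => by
          simp only [Real.norm_eq_abs, abs_mul]
          exact (mul_le_of_le_one_left (abs_nonneg _) (Real.abs_sin_le_one φ)).trans (hq' φ hφ))
        (convex_Icc 0 φ₀)
      intro φ hφ
      have := hmv (right_mem_Icc.mpr hφ₀.1.le) hφ
      simp only [hp0, sub_self, sub_zero, Real.norm_eq_abs] at this
      refine this.trans (mul_le_mul_of_nonneg_left ?_ hε.1.le)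
      rw [abs_le]
      constructor <;> linarith [hφ.1, hφ.2]
    have hH := H p
    rw [hp0, hpd] at hH
    have hle : ∫ φ in Ioo 0 φ₀, ((Real.sin φ * (-q).eval (Real.cos φ)) ^ 2 +
        hardyConst c * p.eval (Real.cos φ) ^ 2) * Real.sin φ ≤
        ∫ φ in Ioo 0 φ₀, ((1 + ε) * (((Real.sin φ * W φ) ^ 2 + hardyConst c * g φ ^ 2) *
          Real.sin φ) + 10 * ε) := by
      have hi1 : IntegrableOn (fun φ => ((Real.sin φ * W φ) ^ 2 + hardyConst c * g φ ^ 2) *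
          Real.sin φ) (Ioo 0 φ₀) := (hcontI.integrableOn_Icc).mono_set Ioo_subset_Icc_self
      refine setIntegral_mono_on ?_ ?_ measurableSet_Ioo ?_
      · have : Continuous fun φ => ((Real.sin φ * (-q).eval (Real.cos φ)) ^ 2 +
            hardyConst c * p.eval (Real.cos φ) ^ 2) * Real.sin φ := by fun_prop
        exact this.integrableOn_Icc.mono_set Ioo_subset_Icc_self
      · exact (hi1.const_mul _).add (integrableOn_const (by simp))
      · intro φ hφ
        have hφI := Ioo_subset_Icc_self hφ
        have hs := hsin φ hφ
        have hs1 := Real.sin_le_one φ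
        have hA := abs_le.mp (hq' φ hφI)
        have hB := abs_le.mp (hD φ hφI)
        rw [Polynomial.eval_neg]
        have hφ4 : φ₀ < 4 := hφ₀.2.trans Real.pi_lt_four
        obtain ⟨a, ha⟩ : ∃ a, a = q.eval (Real.cos φ) - W φ := ⟨_, rfl⟩
        obtain ⟨b, hb⟩ : ∃ b, b = p.eval (Real.cos φ) - g φ := ⟨_, rfl⟩
        rw [← ha] at hA
        rw [← hb] at hB
        rw [show q.eval (Real.cos φ) = W φ + a by rw [ha]; ring,
          show p.eval (Real.cos φ) = g φ + b by rw [hb]; ring]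
        have ha2 : a ^ 2 ≤ ε ^ 2 := sq_le_sq' hA.1 hA.2
        have hb2 : b ^ 2 ≤ (4 * ε) ^ 2 := by
          apply sq_le_sq' <;> nlinarith [hε.1, hφ₀.1]
        -- Young's inequality with weight `ε` compares the energy of `p (cos φ)` with that of `g`
        have young (x y : ℝ) : (x + y) ^ 2 ≤ (1 + ε) * x ^ 2 + (1 + 1 / ε) * y ^ 2 := by
          have h0 := hε.1
          have : (1 + ε) * x ^ 2 + (1 + 1 / ε) * y ^ 2 - (x + y) ^ 2 =
              (ε * x - y) ^ 2 / ε := by field_simp; ring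
          have : 0 ≤ (ε * x - y) ^ 2 / ε := by positivity
          linarith
        have hε' : (1 + 1 / ε) * ε ^ 2 ≤ 2 * ε := by
          have h0 := hε.1
          have : (1 + 1 / ε) * ε ^ 2 = ε ^ 2 + ε := by field_simp
          nlinarith [hε.2]
        have h1ε : 0 ≤ 1 + 1 / ε := by have := hε.1; positivity
        have hsa : (Real.sin φ * a) ^ 2 ≤ ε ^ 2 := by
          rw [mul_pow]
          exact (mul_le_of_le_one_left (sq_nonneg a) (Real.sin_sq_le_one φ)).trans ha2
        have hkb : hardyConst c * b ^ 2 ≤ 4 * ε ^ 2 := by nlinarith [sq_nonneg b]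
        have e1 := young (Real.sin φ * W φ) (Real.sin φ * a)
        have e2 := mul_le_mul_of_nonneg_left (young (g φ) b) hk.le
        have e3 : (1 + 1 / ε) * ((Real.sin φ * a) ^ 2 + hardyConst c * b ^ 2) ≤
            (1 + 1 / ε) * (5 * ε ^ 2) := mul_le_mul_of_nonneg_left (by linarith) h1ε
        have e4 : (Real.sin φ * -(W φ + a)) ^ 2 + hardyConst c * (g φ + b) ^ 2 ≤
            (1 + ε) * ((Real.sin φ * W φ) ^ 2 + hardyConst c * g φ ^ 2) + 10 * ε := by
          have : (Real.sin φ * -(W φ + a)) ^ 2 = (Real.sin φ * W φ + Real.sin φ * a) ^ 2 := by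
            ring
          rw [this]
          linarith
        have e5 := mul_le_mul_of_nonneg_right e4 hs.le
        have e6 : 10 * ε * Real.sin φ ≤ 10 * ε := by nlinarith [hε.1]
        linarith
    have hi1 : IntegrableOn (fun φ => ((Real.sin φ * W φ) ^ 2 + hardyConst c * g φ ^ 2) *
        Real.sin φ) (Ioo 0 φ₀) := (hcontI.integrableOn_Icc).mono_set Ioo_subset_Icc_self
    rw [integral_add (hi1.const_mul _) (integrableOn_const (by simp)), integral_const_mul, hI,
      setIntegral_const, Measure.real, Real.volume_Ioo, sub_zero, ENNReal.toReal_ofReal hφ₀.1.le,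
      smul_eq_mul] at hle
    linarith
  have hlim : Tendsto (fun ε => Real.cos φ₀ * g φ₀ ^ 2 + I + ε * (I + 10 * φ₀)) (𝓝[>] 0)
      (𝓝 (Real.cos φ₀ * g φ₀ ^ 2 + I + 0 * (I + 10 * φ₀))) := by
    apply Tendsto.mono_left _ nhdsWithin_le_nhds
    apply Continuous.tendsto
    fun_prop
  rw [zero_mul, add_zero] at hlim
  exact ge_of_tendsto hlim (eventually_of_mem (Ioo_mem_nhdsGT one_pos) hbound)

end ODE

/-! ### Boundedness of test functions up to the boundary -/

theorem continuous_spherical : Continuous spherical := by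
  unfold spherical conicalSurface
  fun_prop

theorem isOpen_circularCone (φ₀ : ℝ) : IsOpen (circularCone φ₀) := by
  have h1 : Continuous fun x : E3 => ‖x‖ * Real.cos φ₀ := by fun_prop
  have h2 : Continuous fun x : E3 => x 2 := by fun_prop
  exact isOpen_lt h1 h2

theorem spherical_mem_circularCone {φ₀ : ℝ} (hφ₀ : φ₀ ∈ Ioo 0 Real.pi) {q : (ℝ × ℝ) × ℝ}
    (hr : 0 < q.1.1) (hq : q.2 ∈ Ico 0 φ₀) : spherical q ∈ circularCone φ₀ :=
  (spherical_mem_cone_iff hφ₀ hr ⟨hq.1, (hq.2.trans hφ₀.2).le⟩).mpr hq.2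

theorem spherical_mem_closure_circularCone {φ₀ : ℝ} (hφ₀ : φ₀ ∈ Ioo 0 Real.pi)
    {q : (ℝ × ℝ) × ℝ} (hr : 0 < q.1.1) (hq : q.2 ∈ Icc 0 φ₀) :
    spherical q ∈ closure (circularCone φ₀) := by
  rcases hq.2.lt_or_eq with h | h
  · exact subset_closure (spherical_mem_circularCone hφ₀ hr ⟨hq.1, h⟩)
  · have hc : Continuous fun φ => spherical (q.1, φ) :=
      continuous_spherical.comp (by fun_prop)
    have ht : Tendsto (fun φ => spherical (q.1, φ)) (𝓝[<] φ₀) (𝓝 (spherical (q.1, φ₀))) :=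
      (hc.tendsto φ₀).mono_left nhdsWithin_le_nhds
    have : q = (q.1, φ₀) := Prod.ext rfl h
    rw [this]
    exact mem_closure_of_tendsto ht (eventually_of_mem (Ioo_mem_nhdsLT hφ₀.1)
      fun φ hφ => spherical_mem_circularCone hφ₀ hr ⟨hφ.1.le, hφ.2⟩)

/-- A function that is `C¹` up to the boundary of an open set `Γ` has bounded derivative on bounded
parts of `Γ`. No regularity of the boundary is needed. -/
theorem exists_bound_fderiv {Γ : Set E3} (hΓ : IsOpen Γ) {F : E3 → ℝ}
    (hF : ContDiffOn ℝ 1 F (closure Γ)) {K : Set E3} (hK : IsCompact K) (hKΓ : K ⊆ closure Γ) :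
    ∃ M, ∀ x ∈ K ∩ Γ, ‖fderiv ℝ F x‖ ≤ M := by
  refine hK.induction_on (p := fun S => ∃ M, ∀ x ∈ S ∩ Γ, ‖fderiv ℝ F x‖ ≤ M) ⟨0, by simp⟩
    (fun S T hST ⟨M, hM⟩ => ⟨M, fun x hx => hM x ⟨hST hx.1, hx.2⟩⟩) ?_ ?_
  · rintro S T ⟨M, hM⟩ ⟨N, hN⟩
    refine ⟨max M N, fun x hx => ?_⟩
    rcases hx.1 with h | h
    · exact (hM x ⟨h, hx.2⟩).trans (le_max_left _ _)
    · exact (hN x ⟨h, hx.2⟩).trans (le_max_right _ _)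
  · intro x hx
    have h1 : ContDiffWithinAt ℝ (0 + 1) F (closure Γ) x := by
      rw [zero_add]
      exact hF x (hKΓ hx)
    obtain ⟨u, hu, -, f', hf', hf'c⟩ :=
      (contDiffWithinAt_succ_iff_hasFDerivWithinAt (by simp)).mp h1
    rw [insert_eq_of_mem (hKΓ hx)] at hu
    have hev : ∀ᶠ y in 𝓝[u] x, ‖f' y‖ < ‖f' x‖ + 1 :=
      hf'c.continuousWithinAt.norm.eventually_lt_const (by linarith)
    obtain ⟨o, ho, hxo, hou⟩ := mem_nhdsWithin.mp hu
    obtain ⟨o', ho', hxo', hou'⟩ := mem_nhdsWithin.mp hev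
    refine ⟨o ∩ o', mem_nhdsWithin_of_mem_nhds ((ho.inter ho').mem_nhds ⟨hxo, hxo'⟩),
      ‖f' x‖ + 1, fun y hy => ?_⟩
    have hyu : y ∈ u := hou ⟨hy.1.1, subset_closure hy.2⟩
    have hunhds : u ∈ 𝓝 y :=
      mem_of_superset ((ho.inter hΓ).mem_nhds ⟨hy.1.1, hy.2⟩)
        fun z hz => hou ⟨hz.1, subset_closure hz.2⟩
    rw [((hf' y hyu).hasFDerivAt hunhds).fderiv]
    exact le_of_lt (hou' ⟨hy.1.2, hyu⟩)

theorem IsTestFunction.exists_bounds {Γ : Set E3} (hΓ : IsOpen Γ) {F : E3 → ℝ}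
    (hF : IsTestFunction Γ F) :
    ∃ R M : ℝ, 1 < R ∧ (∀ x ∈ closure Γ, ‖x‖ ∉ Ioo R⁻¹ R → F x = 0) ∧
      (∀ x ∈ Γ, ‖x‖ ∉ Ioo R⁻¹ R → fderiv ℝ F x = 0) ∧
      (∀ x ∈ Γ, ‖fderiv ℝ F x‖ ≤ M) ∧ ∀ x ∈ closure Γ, |F x| ≤ M := by
  obtain ⟨hFd, R₀, hR₀, hF0⟩ := hF
  -- a slightly larger radius, so that the derivative vanishes outside the shell as well
  set R := R₀ + 1 with hR
  have hR1 : 1 < R := by linarith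
  have hinv : R⁻¹ < R₀⁻¹ := inv_strictAnti₀ hR₀ (by linarith)
  have hFz : ∀ x ∈ closure Γ, ‖x‖ ∉ Ioo R⁻¹ R → F x = 0 := fun x hx hxR =>
    hF0 x hx fun h => hxR ⟨hinv.trans h.1, h.2.trans (by linarith)⟩
  have hdz : ∀ x ∈ Γ, ‖x‖ ∉ Ioo R⁻¹ R → fderiv ℝ F x = 0 := by
    intro x hx hxR
    have hxI : ‖x‖ ∉ Icc R₀⁻¹ R₀ := fun h =>
      hxR ⟨hinv.trans_le h.1, h.2.trans_lt (by linarith)⟩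
    have hev : F =ᶠ[𝓝 x] fun _ => 0 := by
      filter_upwards [hΓ.mem_nhds hx,
        (isClosed_Icc.isOpen_compl.preimage continuous_norm).mem_nhds hxI] with y hy hyR
      exact hF0 y (subset_closure hy) fun h => hyR (Ioo_subset_Icc_self h)
    rw [hev.fderiv_eq, fderiv_fun_const]
    rfl
  have hK : IsCompact (closure Γ ∩ Metric.closedBall 0 R) :=
    (isCompact_closedBall 0 R).inter_left isClosed_closure
  obtain ⟨M, hM⟩ := exists_bound_fderiv hΓ (hFd.of_le (by simp)) hK inter_subset_left
  obtain ⟨N, hN⟩ := hK.exists_bound_of_continuousOn (hFd.continuousOn.mono inter_subset_left)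
  refine ⟨R, max 0 (max M N), hR1, hFz, hdz, fun x hx => ?_, fun x hx => ?_⟩
  · by_cases h : ‖x‖ ∈ Ioo R⁻¹ R
    · exact (hM x ⟨⟨subset_closure hx, by simpa using h.2.le⟩, hx⟩).trans
        ((le_max_left _ _).trans (le_max_right _ _))
    · rw [hdz x hx h, norm_zero]
      exact le_max_left _ _
  · by_cases h : ‖x‖ ∈ Ioo R⁻¹ R
    · exact (hN x ⟨hx, by simpa using h.2.le⟩).trans
        ((le_max_right _ _).trans (le_max_right _ _))
    · rw [hFz x hx h, abs_zero]
      exact le_max_left _ _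

theorem integrableOn_mul_sq {α : Type*} [TopologicalSpace α] [MeasurableSpace α]
    [OpensMeasurableSpace α] [SecondCountableTopology α] {μ : Measure α} {s : Set α}
    (hs : MeasurableSet s)
    (hμ : μ s ≠ ⊤) {w v : α → ℝ} {W M : ℝ} (hw : ContinuousOn w s) (hv : ContinuousOn v s)
    (hwW : ∀ x ∈ s, |w x| ≤ W) (hvM : ∀ x ∈ s, |v x| ≤ M) :
    IntegrableOn (fun x => w x * v x ^ 2) s μ := by
  have : IsFiniteMeasure (μ.restrict s) := ⟨by simpa using hμ.lt_top⟩
  refine Integrable.of_bound ((hw.mul (hv.pow 2)).aestronglyMeasurable hs) (W * M ^ 2) ?_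
  refine (ae_restrict_iff' hs).mpr (Eventually.of_forall fun x hx => ?_)
  rw [Real.norm_eq_abs, abs_mul, abs_pow]
  have h1 := hwW x hx
  have h2 := hvM x hx
  have h3 := abs_nonneg (w x)
  gcongr
  exact h3.trans h1

/-! ### Stability from the bound on the mean curvature -/

theorem setIntegral_prod_nonneg {α β : Type*} [MeasurableSpace α] [MeasurableSpace β]
    {μ : Measure α} {ν : Measure β} [SFinite μ] [SFinite ν] {f : α × β → ℝ} {s : Set α}
    {t : Set β} (ht : MeasurableSet t) (hf : IntegrableOn f (s ×ˢ t) (μ.prod ν))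
    (h : ∀ y ∈ t, 0 ≤ ∫ x in s, f (x, y) ∂μ) : 0 ≤ ∫ z in s ×ˢ t, f z ∂μ.prod ν := by
  rw [IntegrableOn, ← Measure.prod_restrict] at hf
  rw [← Measure.prod_restrict, integral_prod_symm f hf]
  exact setIntegral_nonneg ht h

/-- Hardy's inequality on an interval for functions vanishing at the end points. -/
theorem hardy_inequality {a b : ℝ} (hab : a ≤ b) {v v' : ℝ → ℝ} (hv : ContinuousOn v (Icc a b))
    (hv' : ∀ r ∈ Ioo a b, HasDerivAt v (v' r) r) (hv'c : ContinuousOn v' (Icc a b))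
    (ha : v a = 0) (hb : v b = 0) :
    0 ≤ ∫ r in Ioo a b, (r ^ 2 * v' r ^ 2 - v r ^ 2 / 4) := by
  have hcont : ContinuousOn (fun r => r ^ 2 * v' r ^ 2 - v r ^ 2 / 4) (Icc a b) := by fun_prop
  -- `r² v'² - v² / 4 = (r v' + v / 2)² - (r v² / 2)'`, a square minus a total derivative
  have key := intervalIntegral.sub_le_integral_of_hasDeriv_right_of_le hab
    (g := fun r => -(r * v r ^ 2) / 2)
    (g' := fun r => -(1 * v r ^ 2 + r * (2 * v r * v' r)) / 2)
    (φ := fun r => r ^ 2 * v' r ^ 2 - v r ^ 2 / 4) (by fun_prop)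
    (fun r hr => by
      refine HasDerivAt.hasDerivWithinAt ?_
      refine ((((hasDerivAt_id r).mul ((hv' r hr).pow 2)).neg).div_const 2).congr_deriv ?_
      simp)
    hcont.integrableOn_Icc
    (fun r _ => by nlinarith [sq_nonneg (r * v' r + v r / 2)])
  rw [intervalIntegral.integral_of_le hab, integral_Ioc_eq_integral_Ioo] at key
  simpa [ha, hb] using key

theorem integral_energyDensity_eq (c : ℝ) {F : E3 → ℝ} {φ₀ R : ℝ} (hφ₀ : φ₀ ∈ Ioo 0 Real.pi)
    (hR : 1 < R) (hF : ∀ x ∈ circularCone φ₀, ‖x‖ ∉ Ioo R⁻¹ R → fderiv ℝ F x = 0) :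
    ∫ x in circularCone φ₀, energyDensity c F x =
      ∫ q in (Ioo R⁻¹ R ×ˢ Ioc (-Real.pi) Real.pi) ×ˢ Ioo 0 φ₀,
        q.1.1 ^ 2 * Real.sin q.2 * energyDensity c F (spherical q) := by
  rw [integral_cone hφ₀]
  have hR0 : 0 < R⁻¹ := by positivity
  refine setIntegral_eq_of_subset_of_forall_sdiff_eq_zero (measurableSet_parameterDomain_prod φ₀)
    (prod_mono (prod_mono (fun r hr => hR0.trans hr.1) subset_rfl) subset_rfl) ?_
  rintro q ⟨hq, hq'⟩
  have hr : 0 < q.1.1 := hq.1.1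
  have hn : ‖spherical q‖ = q.1.1 := norm_conicalSurface _ _ hr
  have hz := hF (spherical q) (spherical_mem_circularCone hφ₀ hr ⟨hq.2.1.le, hq.2.2⟩)
    (by rw [hn]; exact fun h => hq' ⟨⟨h, hq.1.2⟩, hq.2⟩)
  simp [energyDensity, hz]

theorem integral_boundary_eq {F : E3 → ℝ} {φ₀ : ℝ} (hφ₀ : φ₀ ∈ Ioo 0 Real.pi) :
    ∫ p in parameterDomain, meanCurvature (conicalSurface φ₀) p.1 p.2 *
        F (conicalSurface φ₀ p.1 p.2) ^ 2 * areaElement (conicalSurface φ₀) p.1 p.2 =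
      ∫ p in parameterDomain, -Real.cos φ₀ * F (conicalSurface φ₀ p.1 p.2) ^ 2 := by
  refine setIntegral_congr_fun (measurableSet_Ioi.prod measurableSet_Ioc) fun p hp => ?_
  have hr : 0 < p.1 := hp.1
  have hs := Real.sin_pos_of_pos_of_lt_pi hφ₀.1 hφ₀.2
  simp only [meanCurvature_conicalSurface hφ₀ hr, areaElement_conicalSurface hφ₀ hr]
  field_simp

/-- The boundary bound on the profile `g` implies the stability inequality. -/
theorem stabilityInequality_of_le {c φ₀ : ℝ} {g : ℝ → ℝ} (hφ₀ : φ₀ ∈ Ioo 0 Real.pi)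
    (hg : IsRegularSolution c (-1 / 2) g) (hpos : ∀ φ ∈ Ico 0 Real.pi, 0 < g φ)
    (hle : -Real.cos φ₀ ≤ Real.sin φ₀ * (deriv g φ₀ / g φ₀)) :
    StabilityInequality c (circularCone φ₀) (conicalSurface φ₀) := by
  intro F hF
  obtain ⟨R, M, hR, hFz, hdz, hdM, hFM⟩ := hF.exists_bounds (isOpen_circularCone φ₀)
  have hFd := hF.1
  have hR0 : 0 < R⁻¹ := by positivity
  have hRR : R⁻¹ ≤ R := (inv_le_one_of_one_le₀ hR.le).trans hR.le
  rw [integral_boundary_eq hφ₀, integral_energyDensity_eq c hφ₀ hR hdz]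
  set Q : Set (ℝ × ℝ) := Ioo R⁻¹ R ×ˢ Ioc (-Real.pi) Real.pi with hQ
  set B : Set ((ℝ × ℝ) × ℝ) := Q ×ˢ Ioo 0 φ₀ with hB
  have hQm : MeasurableSet Q := measurableSet_Ioo.prod measurableSet_Ioc
  have hBm : MeasurableSet B := hQm.prod measurableSet_Ioo
  have hQv : volume Q ≠ ⊤ := by
    rw [hQ, Measure.volume_eq_prod, Measure.prod_prod]
    exact ENNReal.mul_ne_top (by simp) (by simp)
  have hBv : volume B ≠ ⊤ := by
    rw [hB, Measure.volume_eq_prod, Measure.prod_prod]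
    exact ENNReal.mul_ne_top hQv (by simp)
  have hQpos : ∀ p ∈ Q, 0 < p.1 := fun p hp => hR0.trans hp.1.1
  set S : Set ((ℝ × ℝ) × ℝ) := {q | 0 < q.1.1 ∧ q.2 ∈ Ioo 0 φ₀} with hS
  have hBS : B ⊆ S := fun q hq => ⟨hQpos _ hq.1, hq.2⟩
  have hSΓ : MapsTo spherical S (circularCone φ₀) := fun q hq =>
    spherical_mem_circularCone hφ₀ hq.1 ⟨hq.2.1.le, hq.2.2⟩
  -- the value and the gradient of the test function in spherical coordinates
  set U : (ℝ × ℝ) × ℝ → ℝ := fun q => F (spherical q) with hU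
  set D : (ℝ × ℝ) × ℝ → E3 →L[ℝ] ℝ := fun q => fderiv ℝ F (spherical q) with hD
  set A : (ℝ × ℝ) × ℝ → ℝ := fun q => D q (conicalSurface q.2 1 q.1.2) with hA
  set P : (ℝ × ℝ) × ℝ → ℝ := fun q => D q (polarDir q.2 q.1.2) with hP
  set L : (ℝ × ℝ) × ℝ → ℝ := fun q => D q (longitudeDir q.1.2) with hL
  have hUc : ContinuousOn U {q | 0 < q.1.1 ∧ q.2 ∈ Icc 0 φ₀} :=
    hFd.continuousOn.comp continuous_spherical.continuousOn
      fun q hq => spherical_mem_closure_circularCone hφ₀ hq.1 hq.2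
  have hUcS : ContinuousOn U S := hUc.mono fun q hq => ⟨hq.1, Ioo_subset_Icc_self hq.2⟩
  have hDc : ContinuousOn D S :=
    ((hFd.mono subset_closure).continuousOn_fderiv_of_isOpen (isOpen_circularCone φ₀)
      (by simp)).comp continuous_spherical.continuousOn hSΓ
  have hAc : ContinuousOn A S := hDc.clm_apply (Continuous.continuousOn (by
    unfold conicalSurface; fun_prop))
  have hPc : ContinuousOn P S := hDc.clm_apply (Continuous.continuousOn (by
    unfold polarDir; fun_prop))
  have hLc : ContinuousOn L S := hDc.clm_apply (Continuous.continuousOn (by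
    unfold longitudeDir; fun_prop))
  have hUM : ∀ q, 0 < q.1.1 → q.2 ∈ Icc 0 φ₀ → |U q| ≤ M := fun q h1 h2 =>
    hFM _ (spherical_mem_closure_circularCone hφ₀ h1 h2)
  have hDM : ∀ q ∈ S, ∀ e : E3, inner ℝ e e = 1 → |D q e| ≤ M := by
    intro q hq e he
    rw [real_inner_self_eq_norm_sq] at he
    have hn : ‖e‖ = 1 := (pow_eq_one_iff_of_nonneg (norm_nonneg _) two_ne_zero).mp he
    have := ((D q).le_opNorm e).trans (mul_le_mul_of_nonneg_right (hdM _ (hSΓ hq)) (norm_nonneg e))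
    rwa [hn, mul_one] at this
  have hAM : ∀ q ∈ S, |A q| ≤ M := fun q hq => hDM q hq _ (inner_radius_radius _ _)
  have hPM : ∀ q ∈ S, |P q| ≤ M := fun q hq => hDM q hq _ (inner_polar_polar _ _)
  have hLM : ∀ q ∈ S, |L q| ≤ M := fun q hq => hDM q hq _ (inner_longitude_longitude _)
  have hdiff : ∀ q ∈ S, HasFDerivAt F (D q) (spherical q) := fun q hq =>
    ((hFd.contDiffAt (mem_of_superset ((isOpen_circularCone φ₀).mem_nhds (hSΓ hq))
      subset_closure)).differentiableAt (by simp)).hasFDerivAt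
  have hw : ∀ q ∈ B, |q.1.1 ^ 2 * Real.sin q.2| ≤ R ^ 2 := by
    intro q hq
    rw [abs_mul, abs_pow, abs_of_pos (hQpos _ hq.1)]
    have h1 := (hQpos _ hq.1).le
    have h2 := hq.1.1.2.le
    calc q.1.1 ^ 2 * |Real.sin q.2| ≤ q.1.1 ^ 2 * 1 := by
          gcongr
          exact Real.abs_sin_le_one _
      _ ≤ R ^ 2 := by rw [mul_one]; gcongr
  have hwc : ContinuousOn (fun q : (ℝ × ℝ) × ℝ => q.1.1 ^ 2 * Real.sin q.2) B := by fun_prop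
  have hiU : IntegrableOn (fun q => Real.sin q.2 * U q ^ 2) B :=
    integrableOn_mul_sq hBm hBv (by fun_prop) (hUcS.mono hBS)
      (fun q _ => Real.abs_sin_le_one q.2)
      (fun q hq => hUM q (hBS hq).1 (Ioo_subset_Icc_self hq.2))
  have hiA : IntegrableOn (fun q => q.1.1 ^ 2 * Real.sin q.2 * A q ^ 2) B :=
    integrableOn_mul_sq hBm hBv hwc (hAc.mono hBS) hw fun q hq => hAM q (hBS hq)
  have hiP : IntegrableOn (fun q => q.1.1 ^ 2 * Real.sin q.2 * P q ^ 2) B :=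
    integrableOn_mul_sq hBm hBv hwc (hPc.mono hBS) hw fun q hq => hPM q (hBS hq)
  have hiL : IntegrableOn (fun q => q.1.1 ^ 2 * Real.sin q.2 * L q ^ 2) B :=
    integrableOn_mul_sq hBm hBv hwc (hLc.mono hBS) hw fun q hq => hLM q (hBS hq)
  -- the radial part: Hardy's inequality on each ray
  have hiH : IntegrableOn (fun q => Real.sin q.2 * (q.1.1 ^ 2 * A q ^ 2 - U q ^ 2 / 4)) B := by
    refine (hiA.sub (hiU.div_const 4)).congr (Eventually.of_forall fun q => ?_)
    simp only [Pi.sub_apply]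
    ring
  have hradial : 0 ≤ ∫ q in B, Real.sin q.2 * (q.1.1 ^ 2 * A q ^ 2 - U q ^ 2 / 4) := by
    refine setIntegral_prod_nonneg measurableSet_Ioo hiH fun φ hφ => ?_
    have hsl : ContinuousOn (fun p : ℝ × ℝ => (p, φ)) Q := by fun_prop
    have hslB : MapsTo (fun p : ℝ × ℝ => (p, φ)) Q B := fun p hp => ⟨hp, hφ⟩
    simp only [integral_const_mul]
    have hs := Real.sin_pos_of_pos_of_lt_pi hφ.1 (hφ.2.trans hφ₀.2)
    refine mul_nonneg hs.le ?_
    have hi1 : IntegrableOn (fun p : ℝ × ℝ => p.1 ^ 2 * A (p, φ) ^ 2) Q := by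
      refine integrableOn_mul_sq hQm hQv (W := R ^ 2) (by fun_prop)
        ((hAc.mono hBS).comp hsl hslB) (fun p hp => ?_) (fun p hp => hAM _ (hBS (hslB hp)))
      rw [abs_pow, abs_of_pos (hQpos p hp)]
      have := (hQpos p hp).le
      have := hp.1.2.le
      gcongr
    have hi2 : IntegrableOn (fun p : ℝ × ℝ => 1 * U (p, φ) ^ 2) Q :=
      integrableOn_mul_sq hQm hQv (W := 1) (by fun_prop)
        ((hUcS.mono hBS).comp hsl hslB) (fun p hp => by simp)
        (fun p hp => hUM _ (hQpos p hp) (Ioo_subset_Icc_self hφ))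
    have hi : IntegrableOn (fun p : ℝ × ℝ => p.1 ^ 2 * A (p, φ) ^ 2 - U (p, φ) ^ 2 / 4) Q := by
      refine (hi1.sub (hi2.div_const 4)).congr (Eventually.of_forall fun q => ?_)
      simp only [Pi.sub_apply]
      ring
    refine setIntegral_prod_nonneg measurableSet_Ioc hi fun θ hθ => ?_
    have hray : ContinuousOn (fun r : ℝ => ((r, θ), φ)) (Icc R⁻¹ R) := by fun_prop
    have hrayS : MapsTo (fun r : ℝ => ((r, θ), φ)) (Icc R⁻¹ R) S :=
      fun r hr => ⟨hR0.trans_le hr.1, hφ⟩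
    have hz : ∀ r : ℝ, 0 < r → r ∉ Ioo R⁻¹ R → U ((r, θ), φ) = 0 := fun r hr hrR =>
      hFz _ (spherical_mem_closure_circularCone hφ₀ hr (Ioo_subset_Icc_self hφ))
        (by rwa [show ‖spherical ((r, θ), φ)‖ = r from norm_conicalSurface _ _ hr])
    exact hardy_inequality hRR (hUcS.comp hray hrayS)
      (fun r hr => (hdiff _ (hrayS (Ioo_subset_Icc_self hr))).comp_hasDerivAt r
        (hasDerivAt_conicalSurface_radius φ r θ))
      (hAc.comp hray hrayS) (hz _ hR0 fun h => lt_irrefl _ h.1)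
      (hz _ (by linarith) fun h => lt_irrefl _ h.2)
  -- the angular part: the one-dimensional boundary inequality on each arc
  have hiG : IntegrableOn (fun q =>
      ((q.1.1 * P q) ^ 2 + hardyConst c * U q ^ 2) * Real.sin q.2) B := by
    refine (hiP.add (hiU.const_mul (hardyConst c))).congr (Eventually.of_forall fun q => ?_)
    simp only [Pi.add_apply]
    ring
  have hangular : ∫ p in Q, -Real.cos φ₀ * F (conicalSurface φ₀ p.1 p.2) ^ 2 ≤
      ∫ q in B, ((q.1.1 * P q) ^ 2 + hardyConst c * U q ^ 2) * Real.sin q.2 := by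
    have hiG' := hiG
    rw [IntegrableOn, hB, Measure.volume_eq_prod, ← Measure.prod_restrict] at hiG'
    have hfubini : ∫ q in B, ((q.1.1 * P q) ^ 2 + hardyConst c * U q ^ 2) * Real.sin q.2 =
        ∫ p in Q, ∫ φ in Ioo 0 φ₀, ((p.1 * P (p, φ)) ^ 2 + hardyConst c * U (p, φ) ^ 2) *
          Real.sin φ := setIntegral_prod _ hiG
    rw [hfubini]
    refine setIntegral_mono_on ?_ hiG'.integral_prod_left hQm fun p hp => ?_
    · exact integrableOn_mul_sq hQm hQv (v := fun p => U (p, φ₀)) continuousOn_const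
        (hUc.comp (by fun_prop) fun p hp => ⟨hQpos p hp, hφ₀.1.le, le_rfl⟩)
        (fun p _ => le_rfl) (fun p hp => hUM _ (hQpos p hp) ⟨hφ₀.1.le, le_rfl⟩)
    · have hr := hQpos p hp
      have harc : ContinuousOn (fun φ : ℝ => (p, φ)) (Ioo 0 φ₀) := by fun_prop
      have harcS : MapsTo (fun φ : ℝ => (p, φ)) (Ioo 0 φ₀) S := fun φ hφ => ⟨hr, hφ⟩
      have hv : ContinuousOn (fun φ => U (p, φ)) (Icc 0 φ₀) :=
        hUc.comp (by fun_prop) fun φ hφ => ⟨hr, hφ⟩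
      have hi1 : IntegrableOn (fun φ => (p.1 ^ 2 * Real.sin φ) * P (p, φ) ^ 2) (Ioo 0 φ₀) :=
        integrableOn_mul_sq measurableSet_Ioo (by simp) (by fun_prop) (hPc.comp harc harcS)
          (fun φ hφ => hw (p, φ) ⟨hp, hφ⟩) (fun φ hφ => hPM _ (harcS hφ))
      have hi2 : IntegrableOn (fun φ => Real.sin φ * U (p, φ) ^ 2) (Ioo 0 φ₀) :=
        integrableOn_mul_sq measurableSet_Ioo (by simp) (by fun_prop) (hUcS.comp harc harcS)
          (fun φ _ => Real.abs_sin_le_one φ)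
          (fun φ hφ => hUM _ hr (Ioo_subset_Icc_self hφ))
      have key := hg.boundary_le_integral hpos hφ₀ (v' := fun φ => p.1 * P (p, φ)) hv
        (fun φ hφ => by
          refine ((hdiff _ (harcS hφ)).comp_hasDerivAt φ
            (hasDerivAt_conicalSurface_polar φ p.1 p.2)).congr_deriv ?_
          rw [map_smul, smul_eq_mul])
        (by
          refine (hi1.add (hi2.const_mul (hardyConst c))).congr (Eventually.of_forall fun q => ?_)
          simp only [Pi.add_apply]
          ring)
      refine le_trans ?_ key
      exact mul_le_mul_of_nonneg_right hle (sq_nonneg _)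
  have hlhs : ∫ p in parameterDomain, -Real.cos φ₀ * F (conicalSurface φ₀ p.1 p.2) ^ 2 =
      ∫ p in Q, -Real.cos φ₀ * F (conicalSurface φ₀ p.1 p.2) ^ 2 := by
    refine setIntegral_eq_of_subset_of_forall_sdiff_eq_zero
      (measurableSet_Ioi.prod measurableSet_Ioc)
      (prod_mono (fun r hr => hR0.trans hr.1) subset_rfl) ?_
    rintro p ⟨hp, hpQ⟩
    have hr : 0 < p.1 := hp.1
    have : F (conicalSurface φ₀ p.1 p.2) = 0 :=
      hFz _ (spherical_mem_closure_circularCone (q := (p, φ₀)) hφ₀ hr ⟨hφ₀.1.le, le_rfl⟩)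
        (by rw [norm_conicalSurface _ _ hr]; exact fun h => hpQ ⟨h, hp.2⟩)
    rw [this]
    ring
  have hsplit : ∫ q in B, q.1.1 ^ 2 * Real.sin q.2 * energyDensity c F (spherical q) =
      ∫ q in B, (((q.1.1 * P q) ^ 2 + hardyConst c * U q ^ 2) * Real.sin q.2 +
        4 * hardyConst c * (Real.sin q.2 * (q.1.1 ^ 2 * A q ^ 2 - U q ^ 2 / 4)) +
        q.1.1 ^ 2 * Real.sin q.2 * L q ^ 2) := by
    refine setIntegral_congr_fun hBm fun q hq => ?_
    have hr := hQpos _ hq.1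
    have hc : (1 + c ^ 2) ≠ 0 := by positivity
    simp only [spherical, energyDensity_conicalSurface c F hr, hA, hP, hL, hD, hardyConst]
    field_simp
    ring
  have hLnonneg : 0 ≤ ∫ q in B, q.1.1 ^ 2 * Real.sin q.2 * L q ^ 2 :=
    setIntegral_nonneg hBm fun q hq => by
      have := Real.sin_pos_of_pos_of_lt_pi hq.2.1 (hq.2.2.trans hφ₀.2)
      positivity
  have hiGH : IntegrableOn (fun q => ((q.1.1 * P q) ^ 2 + hardyConst c * U q ^ 2) * Real.sin q.2 +
      4 * hardyConst c * (Real.sin q.2 * (q.1.1 ^ 2 * A q ^ 2 - U q ^ 2 / 4))) B :=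
    hiG.add (hiH.const_mul _)
  rw [hlhs, hsplit, integral_add hiGH hiL,
    integral_add hiG (hiH.const_mul _), integral_const_mul (4 * hardyConst c)]
  have := mul_nonneg (mul_nonneg zero_le_four (hardyConst_pos c).le) hradial
  linarith

/-! ### Separated test functions with a logarithmic cutoff -/

theorem image_exp_div {ε : ℝ} (hε : 0 < ε) : (fun t => Real.exp (t / ε)) '' univ = Ioi 0 := by
  rw [image_univ]
  ext r
  constructor
  · rintro ⟨t, rfl⟩
    exact Real.exp_pos _
  · intro hr
    refine ⟨ε * Real.log r, ?_⟩
    simp only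
    rw [mul_div_cancel_left₀ _ hε.ne', Real.exp_log hr]

theorem hasDerivAt_exp_div (ε t : ℝ) :
    HasDerivAt (fun t => Real.exp (t / ε)) (Real.exp (t / ε) / ε) t := by
  refine ((hasDerivAt_id t).div_const ε).exp.congr_deriv ?_
  simp [div_eq_mul_inv]

theorem injective_exp_div {ε : ℝ} (hε : 0 < ε) :
    InjOn (fun t => Real.exp (t / ε)) univ := by
  intro s _ t _ h
  have := Real.exp_injective h
  field_simp at this
  exact this

theorem abs_exp_div_mul {ε : ℝ} (hε : 0 < ε) (h : ℝ → ℝ) (t : ℝ) :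
    |Real.exp (t / ε) / ε| • ((Real.exp (t / ε))⁻¹ * h (ε * Real.log (Real.exp (t / ε)))) =
      ε⁻¹ * h t := by
  rw [Real.log_exp, abs_of_pos (by positivity), smul_eq_mul, mul_div_cancel₀ _ hε.ne']
  field_simp

/-- Logarithmic change of variables. -/
theorem integral_inv_mul_comp_log {ε : ℝ} (hε : 0 < ε) (h : ℝ → ℝ) :
    ∫ r in Ioi 0, r⁻¹ * h (ε * Real.log r) = ε⁻¹ * ∫ t, h t := by
  rw [← image_exp_div hε, integral_image_eq_integral_abs_deriv_smul MeasurableSet.univ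
    (fun t _ => (hasDerivAt_exp_div ε t).hasDerivWithinAt) (injective_exp_div hε)]
  simp only [abs_exp_div_mul hε, Measure.restrict_univ, integral_const_mul]

theorem integrableOn_inv_mul_comp_log {ε : ℝ} (hε : 0 < ε) {h : ℝ → ℝ} (hh : Integrable h) :
    IntegrableOn (fun r => r⁻¹ * h (ε * Real.log r)) (Ioi 0) := by
  rw [← image_exp_div hε, integrableOn_image_iff_integrableOn_abs_deriv_smul MeasurableSet.univ
    (fun t _ => (hasDerivAt_exp_div ε t).hasDerivWithinAt) (injective_exp_div hε)]
  simp only [abs_exp_div_mul hε, integrableOn_univ]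
  exact hh.const_mul _

/-- The radial factor `r^{-1/2} η(ε log r)` of the test functions: the critical power in Hardy's
inequality with a logarithmic cutoff. It vanishes at `r = 0`, where `(√0)⁻¹ = 0`. -/
noncomputable def radialCutoff (η : ℝ → ℝ) (ε r : ℝ) : ℝ := (√r)⁻¹ * η (ε * Real.log r)

/-- The test function with radial part `radialCutoff` and angular part a polynomial in `cos φ`. -/
noncomputable def separatedTest (η : ℝ → ℝ) (ε : ℝ) (p : Polynomial ℝ) (x : E3) : ℝ :=
  radialCutoff η ε ‖x‖ * p.eval (x 2 / ‖x‖)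

theorem hasDerivAt_radialCutoff {η : ℝ → ℝ} (hη : Differentiable ℝ η) (ε : ℝ) {r : ℝ}
    (hr : 0 < r) :
    HasDerivAt (radialCutoff η ε) ((√r)⁻¹ * (r⁻¹ *
      (ε * deriv η (ε * Real.log r) - η (ε * Real.log r) / 2))) r := by
  have h1 := (Real.hasDerivAt_sqrt hr.ne').inv (Real.sqrt_pos.mpr hr).ne'
  have h2 := (hη (ε * Real.log r)).hasDerivAt.comp r ((Real.hasDerivAt_log hr.ne').const_mul ε)
  refine (h1.mul h2).congr_deriv ?_
  have hs := Real.sqrt_pos.mpr hr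
  have hsq : √r ^ 2 = r := Real.sq_sqrt hr.le
  simp only [Pi.inv_apply, Function.comp_apply]
  rw [hsq]
  field_simp
  ring

theorem radialCutoff_sq {η : ℝ → ℝ} {ε r : ℝ} (hr : 0 < r) :
    radialCutoff η ε r ^ 2 = r⁻¹ * η (ε * Real.log r) ^ 2 := by
  rw [radialCutoff, mul_pow, inv_pow, Real.sq_sqrt hr.le]

theorem radialCutoff_eq_zero {η : ℝ → ℝ} {ε T r : ℝ} (hε : 0 < ε)
    (hη : ∀ t, t ∉ Ioo (-T) T → η t = 0) (hr : 0 ≤ r)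
    (hrR : r ∉ Ioo (Real.exp (T / ε))⁻¹ (Real.exp (T / ε))) : radialCutoff η ε r = 0 := by
  rcases hr.eq_or_lt with h | h
  · simp [radialCutoff, ← h]
  · rw [radialCutoff, hη, mul_zero]
    rintro ⟨h1, h2⟩
    apply hrR
    constructor
    · rw [← Real.exp_neg, ← Real.lt_log_iff_exp_lt h, ← neg_div, div_lt_iff₀ hε]
      linarith
    · rw [← Real.log_lt_iff_lt_exp h, lt_div_iff₀ hε]
      linarith

theorem contDiff_separatedTest {η : ℝ → ℝ} {ε T : ℝ} (hε : 0 < ε) (hη : ContDiff ℝ ∞ η)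
    (hηT : ∀ t, t ∉ Ioo (-T) T → η t = 0) (p : Polynomial ℝ) :
    ContDiff ℝ ∞ (separatedTest η ε p) := by
  rw [contDiff_iff_contDiffAt]
  intro x
  rcases eq_or_ne x 0 with rfl | hx
  · have hev : separatedTest η ε p =ᶠ[𝓝 0] fun _ => 0 := by
      have hpos : 0 < (Real.exp (T / ε))⁻¹ := by positivity
      filter_upwards [Metric.ball_mem_nhds (0 : E3) hpos] with y hy
      rw [mem_ball_zero_iff] at hy
      rw [separatedTest, radialCutoff_eq_zero hε hηT (norm_nonneg y) fun h => h.1.not_ge hy.le,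
        zero_mul]
    exact contDiffAt_const.congr_of_eventuallyEq hev
  · have hn : ‖x‖ ≠ 0 := norm_ne_zero_iff.mpr hx
    have hs : √‖x‖ ≠ 0 := (Real.sqrt_pos.mpr (norm_pos_iff.mpr hx)).ne'
    have h1 : ContDiffAt ℝ ∞ (fun y : E3 => ‖y‖) x := contDiffAt_norm ℝ hx
    have h2 : ContDiffAt ℝ ∞ (fun y : E3 => y 2) x := by fun_prop
    have h3 : ContDiffAt ℝ ∞ (fun y : E3 => ε * Real.log ‖y‖) x :=
      contDiffAt_const.mul (h1.log hn)
    have h4 : ContDiffAt ℝ ∞ (fun s : ℝ => p.eval s) (x 2 / ‖x‖) := by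
      simpa using (p.contDiff_aeval (𝕜 := ℝ) ∞).contDiffAt
    exact (((h1.sqrt hn).inv hs).mul (hη.contDiffAt.comp x h3)).mul
      (ContDiffAt.comp (f := fun y : E3 => y 2 / ‖y‖) x h4 (h2.div h1 hn))

theorem isTestFunction_separatedTest {η : ℝ → ℝ} {ε T : ℝ} (hε : 0 < ε) (hη : ContDiff ℝ ∞ η)
    (hηT : ∀ t, t ∉ Ioo (-T) T → η t = 0) (p : Polynomial ℝ) (Γ : Set E3) :
    IsTestFunction Γ (separatedTest η ε p) := by
  refine ⟨(contDiff_separatedTest hε hη hηT p).contDiffOn, Real.exp (T / ε), Real.exp_pos _,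
    fun x _ hx => ?_⟩
  rw [separatedTest, radialCutoff_eq_zero hε hηT (norm_nonneg x) hx, zero_mul]

theorem separatedTest_conicalSurface (η : ℝ → ℝ) (ε : ℝ) (p : Polynomial ℝ) (φ θ : ℝ) {r : ℝ}
    (hr : 0 < r) :
    separatedTest η ε p (conicalSurface φ r θ) =
      radialCutoff η ε r * p.eval (Real.cos φ) := by
  rw [separatedTest, norm_conicalSurface φ θ hr, conicalSurface_two,
    mul_div_cancel_left₀ _ hr.ne']

theorem energyDensity_separatedTest (c : ℝ) {η : ℝ → ℝ} {ε T : ℝ} (hε : 0 < ε)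
    (hη : ContDiff ℝ ∞ η) (hηT : ∀ t, t ∉ Ioo (-T) T → η t = 0) (p : Polynomial ℝ)
    {φ r : ℝ} (hφ : φ ∈ Ioo 0 Real.pi) (hr : 0 < r) (θ : ℝ) :
    r ^ 2 * Real.sin φ * energyDensity c (separatedTest η ε p) (conicalSurface φ r θ) =
      r⁻¹ * (ε * deriv η (ε * Real.log r) - η (ε * Real.log r) / 2) ^ 2 *
          (p.eval (Real.cos φ) ^ 2 * Real.sin φ / (1 + c ^ 2)) +
        r⁻¹ * η (ε * Real.log r) ^ 2 *
          ((Real.sin φ * (Polynomial.derivative p).eval (Real.cos φ)) ^ 2 * Real.sin φ) := by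
  have hs := Real.sin_pos_of_pos_of_lt_pi hφ.1 hφ.2
  have hd : HasFDerivAt (separatedTest η ε p)
      (fderiv ℝ (separatedTest η ε p) (conicalSurface φ r θ)) (conicalSurface φ r θ) :=
    ((contDiff_separatedTest hε hη hηT p).differentiable (by simp)).differentiableAt.hasFDerivAt
  have hrad : fderiv ℝ (separatedTest η ε p) (conicalSurface φ r θ) (conicalSurface φ 1 θ) =
      (√r)⁻¹ * (r⁻¹ * (ε * deriv η (ε * Real.log r) - η (ε * Real.log r) / 2)) *
        p.eval (Real.cos φ) := by
    have h1 := hd.comp_hasDerivAt r (hasDerivAt_conicalSurface_radius φ r θ)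
    have h2 := (hasDerivAt_radialCutoff (hη.differentiable (by simp)) ε hr).mul_const
      (p.eval (Real.cos φ))
    refine h1.unique (h2.congr_of_eventuallyEq ?_)
    filter_upwards [lt_mem_nhds hr] with s hs
    exact separatedTest_conicalSurface η ε p φ θ hs
  have hpol : r * fderiv ℝ (separatedTest η ε p) (conicalSurface φ r θ) (polarDir φ θ) =
      radialCutoff η ε r * ((Polynomial.derivative p).eval (Real.cos φ) * -Real.sin φ) := by
    have h1 := hd.comp_hasDerivAt φ (hasDerivAt_conicalSurface_polar φ r θ)
    rw [map_smul, smul_eq_mul] at h1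
    have h2 := ((p.hasDerivAt (Real.cos φ)).comp φ (Real.hasDerivAt_cos φ)).const_mul
      (radialCutoff η ε r)
    exact h1.unique (h2.congr_of_eventuallyEq (Eventually.of_forall fun ψ =>
      separatedTest_conicalSurface η ε p ψ θ hr))
  have hlon : fderiv ℝ (separatedTest η ε p) (conicalSurface φ r θ) (longitudeDir θ) = 0 := by
    have h1 := hd.comp_hasDerivAt θ (hasDerivAt_conicalSurface_longitude φ r θ)
    rw [map_smul, smul_eq_mul] at h1
    have h2 := hasDerivAt_const θ (radialCutoff η ε r * p.eval (Real.cos φ))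
    have := h1.unique (h2.congr_of_eventuallyEq (Eventually.of_forall fun ψ =>
      separatedTest_conicalSurface η ε p φ ψ hr))
    exact (mul_eq_zero.mp this).resolve_left (by positivity)
  have hsq : √r ^ 2 = r := Real.sq_sqrt hr.le
  have hc : (1 + c ^ 2) ≠ 0 := by positivity
  have hpol' : r ^ 2 * (fderiv ℝ (separatedTest η ε p) (conicalSurface φ r θ)
      (polarDir φ θ)) ^ 2 = r⁻¹ * η (ε * Real.log r) ^ 2 *
        (Real.sin φ * (Polynomial.derivative p).eval (Real.cos φ)) ^ 2 := by
    rw [← mul_pow, hpol, mul_pow, radialCutoff_sq hr]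
    ring
  have hrad' : r ^ 2 * (fderiv ℝ (separatedTest η ε p) (conicalSurface φ r θ)
      (conicalSurface φ 1 θ)) ^ 2 = r⁻¹ *
        (ε * deriv η (ε * Real.log r) - η (ε * Real.log r) / 2) ^ 2 *
          p.eval (Real.cos φ) ^ 2 := by
    rw [hrad, mul_pow, mul_pow, inv_pow, hsq]
    field_simp
  rw [energyDensity_conicalSurface c _ hr, hlon]
  linear_combination Real.sin φ / (1 + c ^ 2) * hrad' + Real.sin φ * hpol'

theorem setIntegral_parameterDomain (h : ℝ → ℝ) :
    ∫ p in parameterDomain, h p.1 = (∫ r in Ioi 0, h r) * (2 * Real.pi) := by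
  have := setIntegral_prod_mul (μ := volume) (ν := volume) h (fun _ : ℝ => (1 : ℝ)) (Ioi 0)
    (Ioc (-Real.pi) Real.pi)
  simp only [mul_one] at this
  rw [parameterDomain, Measure.volume_eq_prod, this]
  congr 1
  rw [setIntegral_const, Measure.real, Real.volume_Ioc, smul_eq_mul, mul_one,
    ENNReal.toReal_ofReal (by linarith [Real.pi_pos])]
  ring

theorem integrableOn_parameterDomain_prod {h k : ℝ → ℝ} {φ₀ : ℝ} (hh : IntegrableOn h (Ioi 0))
    (hk : IntegrableOn k (Ioo 0 φ₀)) :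
    IntegrableOn (fun q : (ℝ × ℝ) × ℝ => h q.1.1 * k q.2) (parameterDomain ×ˢ Ioo 0 φ₀) := by
  have h1 : IntegrableOn (fun _ : ℝ => (1 : ℝ)) (Ioc (-Real.pi) Real.pi) :=
    integrableOn_const (by simp)
  have h2 := Integrable.mul_prod (Integrable.mul_prod hh h1) hk
  rw [Measure.prod_restrict, Measure.prod_restrict] at h2
  simp only [mul_one] at h2
  exact h2

theorem setIntegral_parameterDomain_prod (h k : ℝ → ℝ) (φ₀ : ℝ) :
    ∫ q in parameterDomain ×ˢ Ioo 0 φ₀, h q.1.1 * k q.2 =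
      (∫ r in Ioi 0, h r) * (2 * Real.pi) * ∫ φ in Ioo 0 φ₀, k φ := by
  rw [← setIntegral_parameterDomain, ← setIntegral_prod_mul (fun p : ℝ × ℝ => h p.1) k]
  rfl


theorem integrable_of_hasCompactSupport_left {η h : ℝ → ℝ} (hη : HasCompactSupport η)
    (hh : Continuous h) (h0 : ∀ t, η t = 0 → deriv η t = 0 → h t = 0) : Integrable h := by
  refine hh.integrable_of_hasCompactSupport (HasCompactSupport.intro hη fun t ht => ?_)
  exact h0 t (image_eq_zero_of_notMem_tsupport ht)
    (Function.notMem_support.mp fun hs => ht (support_deriv_subset hs))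

/-- Stability, tested on `radialCutoff η ε r * p (cos φ)`, in terms of one-dimensional integrals. -/
theorem StabilityInequality.separated {c φ₀ : ℝ} (hφ₀ : φ₀ ∈ Ioo 0 Real.pi)
    (H : StabilityInequality c (circularCone φ₀) (conicalSurface φ₀))
    {η : ℝ → ℝ} {ε T : ℝ} (hε : 0 < ε)
    (hη : ContDiff ℝ ∞ η) (hηT : ∀ t, t ∉ Ioo (-T) T → η t = 0) (p : Polynomial ℝ) :
    -Real.cos φ₀ * p.eval (Real.cos φ₀) ^ 2 * ∫ t, η t ^ 2 ≤
      (∫ t, (ε * deriv η t - η t / 2) ^ 2) *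
          (∫ φ in Ioo 0 φ₀, p.eval (Real.cos φ) ^ 2 * Real.sin φ / (1 + c ^ 2)) +
        (∫ t, η t ^ 2) * ∫ φ in Ioo 0 φ₀,
          (Real.sin φ * (Polynomial.derivative p).eval (Real.cos φ)) ^ 2 * Real.sin φ := by
  have hηsupp : HasCompactSupport η :=
    HasCompactSupport.intro (isCompact_Icc (a := -T) (b := T))
      fun t ht => hηT t fun h => ht (Ioo_subset_Icc_self h)
  have hηc := hη.continuous
  have hη'c : Continuous (deriv η) := hη.continuous_deriv (by simp)
  have hi1 : Integrable fun t => η t ^ 2 :=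
    integrable_of_hasCompactSupport_left hηsupp (by fun_prop) fun t h _ => by simp [h]
  have hi2 : Integrable fun t => (ε * deriv η t - η t / 2) ^ 2 :=
    integrable_of_hasCompactSupport_left hηsupp (by fun_prop) fun t h h' => by simp [h, h']
  have hk1 : IntegrableOn (fun φ => p.eval (Real.cos φ) ^ 2 * Real.sin φ / (1 + c ^ 2))
      (Ioo 0 φ₀) := by
    have : Continuous fun φ => p.eval (Real.cos φ) ^ 2 * Real.sin φ / (1 + c ^ 2) := by fun_prop
    exact this.integrableOn_Icc.mono_set Ioo_subset_Icc_self
  have hk2 : IntegrableOn (fun φ =>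
      (Real.sin φ * (Polynomial.derivative p).eval (Real.cos φ)) ^ 2 * Real.sin φ)
      (Ioo 0 φ₀) := by
    have : Continuous fun φ =>
      (Real.sin φ * (Polynomial.derivative p).eval (Real.cos φ)) ^ 2 * Real.sin φ := by fun_prop
    exact this.integrableOn_Icc.mono_set Ioo_subset_Icc_self
  have key := H _ (isTestFunction_separatedTest hε hη hηT p _)
  have hl : ∫ q in parameterDomain, -Real.cos φ₀ *
      separatedTest η ε p (conicalSurface φ₀ q.1 q.2) ^ 2 =
      ∫ q in parameterDomain, -Real.cos φ₀ * p.eval (Real.cos φ₀) ^ 2 *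
        (q.1⁻¹ * η (ε * Real.log q.1) ^ 2) := by
    refine setIntegral_congr_fun (measurableSet_Ioi.prod measurableSet_Ioc) fun q hq => ?_
    have hr : 0 < q.1 := hq.1
    rw [separatedTest_conicalSurface _ _ _ _ _ hr, mul_pow, radialCutoff_sq hr]
    ring
  have hr : ∫ q in parameterDomain ×ˢ Ioo 0 φ₀, q.1.1 ^ 2 * Real.sin q.2 *
      energyDensity c (separatedTest η ε p) (spherical q) =
      ∫ q in parameterDomain ×ˢ Ioo 0 φ₀,
        (q.1.1⁻¹ * (ε * deriv η (ε * Real.log q.1.1) - η (ε * Real.log q.1.1) / 2) ^ 2 *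
          (p.eval (Real.cos q.2) ^ 2 * Real.sin q.2 / (1 + c ^ 2)) +
        q.1.1⁻¹ * η (ε * Real.log q.1.1) ^ 2 *
          ((Real.sin q.2 * (Polynomial.derivative p).eval (Real.cos q.2)) ^ 2 *
            Real.sin q.2)) :=
    setIntegral_congr_fun (measurableSet_parameterDomain_prod φ₀) fun q hq =>
      energyDensity_separatedTest c hε hη hηT p ⟨hq.2.1, hq.2.2.trans hφ₀.2⟩ hq.1.1 _
  rw [integral_boundary_eq hφ₀, integral_cone hφ₀, hl, hr, integral_const_mul,
    setIntegral_parameterDomain (fun r => r⁻¹ * η (ε * Real.log r) ^ 2),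
    integral_add
      (integrableOn_parameterDomain_prod
        (h := fun r => r⁻¹ * (ε * deriv η (ε * Real.log r) - η (ε * Real.log r) / 2) ^ 2)
        (integrableOn_inv_mul_comp_log hε hi2) hk1)
      (integrableOn_parameterDomain_prod (h := fun r => r⁻¹ * η (ε * Real.log r) ^ 2)
        (integrableOn_inv_mul_comp_log hε hi1) hk2),
    setIntegral_parameterDomain_prod
      (fun r => r⁻¹ * (ε * deriv η (ε * Real.log r) - η (ε * Real.log r) / 2) ^ 2)
      (fun φ => p.eval (Real.cos φ) ^ 2 * Real.sin φ / (1 + c ^ 2)),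
    setIntegral_parameterDomain_prod (fun r => r⁻¹ * η (ε * Real.log r) ^ 2)
      (fun φ => (Real.sin φ * (Polynomial.derivative p).eval (Real.cos φ)) ^ 2 * Real.sin φ),
    integral_inv_mul_comp_log hε (fun t => (ε * deriv η t - η t / 2) ^ 2),
    integral_inv_mul_comp_log hε (fun t => η t ^ 2)] at key
  have hscale : 0 < ε⁻¹ * (2 * Real.pi) := by have := Real.pi_pos; positivity
  refine le_of_mul_le_mul_left ?_ hscale
  linarith

/-- Letting the logarithmic cutoff spread out removes the radial variable from the stability
inequality: only Hardy's constant `1/4` remains. -/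
theorem StabilityInequality.polynomial {c φ₀ : ℝ} (hφ₀ : φ₀ ∈ Ioo 0 Real.pi)
    (H : StabilityInequality c (circularCone φ₀) (conicalSurface φ₀)) (p : Polynomial ℝ) :
    0 ≤ Real.cos φ₀ * p.eval (Real.cos φ₀) ^ 2 +
      ∫ φ in Ioo 0 φ₀, ((Real.sin φ * (Polynomial.derivative p).eval (Real.cos φ)) ^ 2 +
        hardyConst c * p.eval (Real.cos φ) ^ 2) * Real.sin φ := by
  let η : ContDiffBump (0 : ℝ) := ⟨1, 2, one_pos, one_lt_two⟩
  have hη : ContDiff ℝ ∞ η := η.contDiff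
  have hηT : ∀ t, t ∉ Ioo (-2 : ℝ) 2 → η t = 0 := by
    intro t ht
    apply η.zero_of_le_dist
    rw [dist_zero_right, Real.norm_eq_abs]
    by_contra! h
    exact ht (abs_lt.mp h)
  have hηsupp : HasCompactSupport η := η.hasCompactSupport
  have hηc : Continuous η := hη.continuous
  have hη'c : Continuous (deriv η) := hη.continuous_deriv (by simp)
  have hi1 : Integrable fun t => η t ^ 2 :=
    integrable_of_hasCompactSupport_left hηsupp (by fun_prop) fun t h _ => by simp [h]
  have hi2 : Integrable fun t => deriv η t ^ 2 :=
    integrable_of_hasCompactSupport_left hηsupp (by fun_prop) fun t _ h' => by simp [h']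
  have hi3 : Integrable fun t => 2 * η t * deriv η t :=
    integrable_of_hasCompactSupport_left hηsupp (by fun_prop) fun t h _ => by simp [h]
  have hcross : ∫ t, 2 * η t * deriv η t = 0 := by
    refine integral_eq_zero_of_hasDerivAt_of_integrable (f := fun t => η t ^ 2) (fun t => ?_)
      hi3 hi1
    refine (((hη.differentiable (by simp)) t).hasDerivAt.pow 2).congr_deriv ?_
    norm_num
  set S := ∫ t, η t ^ 2 with hS
  set D := ∫ t, deriv η t ^ 2 with hD
  have hSpos : 0 < S := by
    refine (integral_pos_iff_support_of_nonneg (fun t => sq_nonneg (η t)) hi1).mpr ?_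
    refine lt_of_lt_of_le ?_ (measure_mono (s := Ioo (-2 : ℝ) 2) ?_)
    · simp
    · intro t ht
      have : 0 < η t := η.pos_of_mem_ball (by simpa [Real.ball_eq_Ioo] using ht)
      exact (pow_pos this 2).ne'
  set A := ∫ φ in Ioo 0 φ₀, p.eval (Real.cos φ) ^ 2 * Real.sin φ / (1 + c ^ 2) with hA
  set B := ∫ φ in Ioo 0 φ₀,
    (Real.sin φ * (Polynomial.derivative p).eval (Real.cos φ)) ^ 2 * Real.sin φ with hB
  have hsplit : ∫ φ in Ioo 0 φ₀, ((Real.sin φ * (Polynomial.derivative p).eval (Real.cos φ)) ^ 2 +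
      hardyConst c * p.eval (Real.cos φ) ^ 2) * Real.sin φ = B + A / 4 := by
    have hk1 : IntegrableOn (fun φ => p.eval (Real.cos φ) ^ 2 * Real.sin φ / (1 + c ^ 2))
        (Ioo 0 φ₀) := by
      have : Continuous fun φ => p.eval (Real.cos φ) ^ 2 * Real.sin φ / (1 + c ^ 2) := by fun_prop
      exact this.integrableOn_Icc.mono_set Ioo_subset_Icc_self
    have hk2 : IntegrableOn (fun φ =>
        (Real.sin φ * (Polynomial.derivative p).eval (Real.cos φ)) ^ 2 * Real.sin φ)
        (Ioo 0 φ₀) := by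
      have : Continuous fun φ =>
        (Real.sin φ * (Polynomial.derivative p).eval (Real.cos φ)) ^ 2 * Real.sin φ := by fun_prop
      exact this.integrableOn_Icc.mono_set Ioo_subset_Icc_self
    rw [hA, hB, ← integral_div, ← integral_add hk2 (hk1.div_const 4)]
    refine integral_congr_ae (Eventually.of_forall fun φ => ?_)
    have hc : (1 + c ^ 2) ≠ 0 := by positivity
    simp only [hardyConst]
    field_simp
  have hineq : ∀ ε : ℝ, 0 < ε →
      0 ≤ Real.cos φ₀ * p.eval (Real.cos φ₀) ^ 2 * S + (ε ^ 2 * D + S / 4) * A + S * B := by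
    intro ε hε
    have key := H.separated hφ₀ hε hη hηT p
    have hexp : ∫ t, (ε * deriv η t - η t / 2) ^ 2 = ε ^ 2 * D + S / 4 := by
      have : ∀ t, (ε * deriv η t - η t / 2) ^ 2 =
          (ε ^ 2 * deriv η t ^ 2 + η t ^ 2 / 4) - ε / 2 * (2 * η t * deriv η t) := fun t => by ring
      simp only [this]
      have hi12 : Integrable fun t => ε ^ 2 * deriv η t ^ 2 + η t ^ 2 / 4 :=
        (hi2.const_mul _).add (hi1.div_const _)
      rw [integral_sub hi12 (hi3.const_mul _),
        integral_add (hi2.const_mul _) (hi1.div_const _), integral_const_mul, integral_div,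
        integral_const_mul, hcross]
      ring
    rw [hexp] at key
    linarith
  have hlim : Tendsto (fun ε : ℝ => Real.cos φ₀ * p.eval (Real.cos φ₀) ^ 2 * S +
      (ε ^ 2 * D + S / 4) * A + S * B) (𝓝[>] 0)
      (𝓝 (Real.cos φ₀ * p.eval (Real.cos φ₀) ^ 2 * S + (0 ^ 2 * D + S / 4) * A + S * B)) := by
    apply Tendsto.mono_left _ nhdsWithin_le_nhds
    apply Continuous.tendsto (f := fun ε : ℝ => Real.cos φ₀ * p.eval (Real.cos φ₀) ^ 2 * S +
      (ε ^ 2 * D + S / 4) * A + S * B)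
    fun_prop
  have h0 := ge_of_tendsto hlim (eventually_of_mem self_mem_nhdsWithin hineq)
  rw [hsplit]
  refine nonneg_of_mul_nonneg_right (a := S) (b := Real.cos φ₀ * p.eval (Real.cos φ₀) ^ 2 +
    (B + A / 4)) ?_ hSpos
  linarith

end OnePhaseCone


open OnePhaseCone

theorem lemmal (c : ℝ) (hc : 0 ≤ c) (f : ℝ → ℝ) (φ₀ : ℝ) (hf : IsSymmetricProfile c f φ₀)
    (g : ℝ → ℝ) (hg : IsRegularSolution c (-1 / 2) g)
    (hg_pos : ∀ φ ∈ Set.Ico 0 Real.pi, 0 < g φ) :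
    StabilityInequality c (positivitySet (symmetricSolution f φ₀)) (conicalSurface φ₀) ↔
      ∀ θ : ℝ, meanCurvature (conicalSurface φ₀) 1 θ ≤ deriv g φ₀ / g φ₀ := by
  have hφ₀ := hf.mem
  have hs := Real.sin_pos_of_pos_of_lt_pi hφ₀.1 hφ₀.2
  have hgp := hg_pos φ₀ ⟨hφ₀.1.le, hφ₀.2⟩
  have hΓ : positivitySet (symmetricSolution f φ₀) = circularCone φ₀ :=
    positivitySet_symmetricSolution hf
  simp only [hΓ, meanCurvature_conicalSurface hφ₀ one_pos, one_mul, forall_const]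
  constructor
  · intro H
    have h := hg.nonneg_of_forall_polynomial hg_pos hφ₀ (H.polynomial hφ₀)
    rw [div_le_div_iff₀ hs hgp]
    refine le_of_mul_le_mul_right ?_ hgp
    linarith
  · intro h
    refine stabilityInequality_of_le hφ₀ hg hg_pos ?_
    rwa [div_le_iff₀ hs, mul_comm] at h
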